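/- **Classification of the coadjoint orbits of the centrally extended planon group for $n=3$.** *Setting.* Let $\mathfrak g$ be the 13-dimensional real Lie algebra with basis $L_{ab}=-L_{ba}$, $P_a$, $D_a$, $Q$, $Z$, $H$, $W$ ($a,b=1,2,3$) in which the $L_{ab}$ span $\mathfrak{so}(3)$, $P_a$ and $D_a$ are vectors, $Q,Z,H,W$ are scalars under rotations, and the remaining nonzero brackets are $$[P_a,Z]=D_a,\qquad [P_a,D_b]=\delta_{ab}Q,\qquad [H,Z]=W .$$ For $\boldsymbol l\in\mathbb R^3$ let $L(\boldsymbol l)$ be the rotation generator with $[L(\boldsymbol l),\boldsymbol v\cdot\boldsymbol P]=(\boldsymbol l\times\boldsymbol v)\cdot\boldsymbol P$. Let $G$ be the connected, simply-connected Lie group with Lie algebra $\mathfrak g$; its elements are written uniquely as $$\mathsf g(\varphi,\tilde\varphi,\boldsymbol\beta,\boldsymbol a,R,s,w)=e^{\varphi Q+\tilde\varphi Z}\,e^{\boldsymbol\beta\cdot\boldsymbol D}\,e^{\boldsymbol a\cdot\boldsymbol P}\,R\;e^{sH+wW},\qquad R\in\mathrm{Spin}(3),$$ where $R$ acts on $\mathbb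 R^3$ by the associated rotation and $\pm I$ is the centre of $\mathrm{Spin}(3)$. Let $\mathsf M(q,\tilde q,\boldsymbol d,\boldsymbol p,\boldsymbol j,E,c)\in\mathfrak g^*$ be the linear form with values $q$ on $Q$, $\tilde q$ on $Z$, $-d_a$ on $D_a$, $p_a$ on $P_a$, $\boldsymbol j\cdot\boldsymbol l$ on $L(\boldsymbol l)$, $E$ on $H$ and $c$ on $W$. $G$ acts on $\mathfrak g^*$ by the coadjoint action. Let $B\subset G$ be the Bargmann group $\{s=w=0\}$, with Lie algebra $\mathfrak b=\langle L_{ab},P_a,D_a,Q,Z\rangle$, and $A=\{e^{sH+wW}\}$. Fix perpendicular unit vectors $\boldsymbol u,\boldsymbol u^\perp\in\mathbb R^3$. *Statement.* The subgroup $A$ is abelian and normal, and $G=B\ltimes A$. Every coadjoint orbit of $G$ occurs in the following list, for exactly one row and one value of the parameters. In each row, the orbit of the representative is precisely the set of moments $\mathsf M(q,\tilde q,\boldsymbol d,\boldsymbol p,\boldsymbol j,E,c)$ satisfying the equations, the stabiliser of the representative is precisely the given subgroup (parameters of $\mathsf g$ that are not mentioned are arbitrary), and the orbit has the dimension given by the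 number in the label. The parameters range over: $\ell,d_0,p_0>0$; $q_0,c_0,\lambda\neq0$; $h,\tilde q_0,\epsilon_0\in\mathbb R$; $E_0\in\mathbb R$, except that $E_0>0$ in $6'''_\pm$. Orbits with $c=0$ (in all of them also $E=E_0$): - $0$: $\mathsf M(0,\tilde q_0,\boldsymbol 0,\boldsymbol 0,\boldsymbol 0,E_0,0)$; stabiliser $G$; $q=0$, $\tilde q=\tilde q_0$, $\boldsymbol d=\boldsymbol p=\boldsymbol j=\boldsymbol 0$. - $2$: $\mathsf M(0,\tilde q_0,\boldsymbol 0,\boldsymbol 0,\ell\boldsymbol u,E_0,0)$; $R\boldsymbol u=\boldsymbol u$; $q=0$, $\tilde q=\tilde q_0$, $\boldsymbol d=\boldsymbol p=\boldsymbol 0$, $\|\boldsymbol j\|=\ell$. - $4$: $\mathsf M(0,\tilde q_0,\boldsymbol 0,p_0\boldsymbol u,h\boldsymbol u,E_0,0)$; $R\boldsymbol u=\boldsymbol u$, $\boldsymbol a\in\mathbb R\boldsymbol u$; $q=0$, $\tilde q=\tilde q_0$, $\boldsymbol d=\boldsymbol 0$, $\|\boldsymbol p\|=p_0$, $\boldsymbol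 j\cdot\boldsymbol p=hp_0$. - $6$: $\mathsf M(q_0,\tilde q_0,\boldsymbol 0,\boldsymbol 0,\boldsymbol 0,E_0,0)$; $\boldsymbol\beta=\boldsymbol a=\boldsymbol 0$; $q=q_0$, $\tilde q-\frac1{2q}\|\boldsymbol d\|^2=\tilde q_0$, $q\boldsymbol j=\boldsymbol d\times\boldsymbol p$. - $6'$: $\mathsf M(0,0,d_0\boldsymbol u,\boldsymbol 0,h\boldsymbol u,E_0,0)$; $\tilde\varphi=0$, $R\boldsymbol u=\boldsymbol u$, $\boldsymbol\beta\in\mathbb R\boldsymbol u$, $\boldsymbol a\cdot\boldsymbol u=0$; $q=0$, $\|\boldsymbol d\|=d_0$, $\boldsymbol d\times\boldsymbol p=\boldsymbol 0$, $\boldsymbol j\cdot\boldsymbol d=hd_0$. - $8$: $\mathsf M(q_0,\tilde q_0,\boldsymbol 0,\boldsymbol 0,\ell\boldsymbol u,E_0,0)$; $\boldsymbol\beta=\boldsymbol a=\boldsymbol 0$, $R\boldsymbol u=\boldsymbol u$; $q=q_0$, $\tilde q-\frac1{2q}\|\boldsymbol d\|^2=\tilde q_0$, $\|\boldsymbol j-\frac1q\boldsymbol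 d\times\boldsymbol p\|=\ell$. - $8'$: $\mathsf M(0,0,d_0\boldsymbol u,p_0\boldsymbol u^\perp,\boldsymbol 0,E_0,0)$; $\tilde\varphi=0$, $\boldsymbol\beta\in\mathbb R\boldsymbol u$, $\boldsymbol a\in\mathbb R\boldsymbol u^\perp$, $R=\pm I$; $q=0$, $\|\boldsymbol d\|=d_0$, $\|\boldsymbol d\times\boldsymbol p\|=d_0p_0$. Orbits with $c=c_0\neq0$ and $q=0$: - $2'$: $\mathsf M(0,0,\boldsymbol 0,\boldsymbol 0,\boldsymbol 0,0,c_0)$; $\tilde\varphi=s=0$; $\boldsymbol p=\boldsymbol d=\boldsymbol j=\boldsymbol 0$. - $4'$: $\mathsf M(0,0,\boldsymbol 0,\boldsymbol 0,\ell\boldsymbol u,0,c_0)$; $\tilde\varphi=s=0$, $R\boldsymbol u=\boldsymbol u$; $\boldsymbol p=\boldsymbol d=\boldsymbol 0$, $\|\boldsymbol j\|=\ell$. - $6''$: $\mathsf M(0,0,\boldsymbol 0,p_0\boldsymbol u,h\boldsymbol u,0,c_0)$; $\tilde\varphi=s=0$, $R\boldsymbol u=\boldsymbol u$, $\boldsymbol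 a\in\mathbb R\boldsymbol u$; $\boldsymbol d=\boldsymbol 0$, $\|\boldsymbol p\|=p_0$, $\boldsymbol j\cdot\boldsymbol p=hp_0$. - $6'''_\pm$ (two families, one for each sign): $\mathsf M(0,0,d_0\boldsymbol u,\pm\frac{E_0d_0}{c_0}\boldsymbol u,h\boldsymbol u,0,c_0)$; $\tilde\varphi=0$, $s=\frac{d_0}{c_0}\boldsymbol a\cdot\boldsymbol u$, $R\boldsymbol u=\boldsymbol u$, $(d_0\boldsymbol\beta\mp\frac{E_0d_0}{c_0}\boldsymbol a)\times\boldsymbol u=\boldsymbol 0$; $\boldsymbol p\times\boldsymbol d=\boldsymbol 0$, $\|\boldsymbol d\|=d_0$, $\boldsymbol j\cdot\boldsymbol d=hd_0$, $E\boldsymbol d+c\boldsymbol p=\pm E_0\boldsymbol d$. - $6'''_0$: $\mathsf M(0,0,d_0\boldsymbol u,\boldsymbol 0,h\boldsymbol u,0,c_0)$; $\tilde\varphi=0$, $s=\frac{d_0}{c_0}\boldsymbol a\cdot\boldsymbol u$, $R\boldsymbol u=\boldsymbol u$, $d_0\boldsymbol\beta\times\boldsymbol u=\boldsymbol 0$;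 $\boldsymbol p=-\frac Ec\boldsymbol d$, $\|\boldsymbol d\|=d_0$, $\boldsymbol j\cdot\boldsymbol d=hd_0$. - $8''$: $\alpha=\mathsf M(0,0,d_0\boldsymbol u,\boldsymbol p_0,\boldsymbol 0,0,c_0)$ with $\boldsymbol p_0=p_0\boldsymbol u^\perp+\frac{\epsilon_0d_0}{c_0}\boldsymbol u$; $\tilde\varphi=0$, $s=\frac{d_0}{c_0}\boldsymbol a\cdot\boldsymbol u$, $R=\pm I$, $\boldsymbol a\times\boldsymbol p_0=\boldsymbol\beta\times d_0\boldsymbol u$; $\|\boldsymbol d\|=d_0$, $\|\boldsymbol p\times\boldsymbol d\|=p_0d_0$, $(E-\epsilon_0)d_0^2=-c\,\boldsymbol p\cdot\boldsymbol d$. Orbits with $c=c_0\neq0$ and $q=\lambda c$, $\lambda\neq0$: - $8'''$: $\mathsf M(\lambda c_0,0,\boldsymbol 0,\boldsymbol 0,\boldsymbol 0,0,c_0)$; $\tilde\varphi=s=0$, $\boldsymbol\beta=\boldsymbol a=\boldsymbol 0$; $q\boldsymbol j=\boldsymbol d\times\boldsymbol p$. - $10$: $\mathsf M(\lambda c_0,0,\boldsymbol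 0,\boldsymbol 0,\ell\boldsymbol u,0,c_0)$; $\tilde\varphi=s=0$, $\boldsymbol\beta=\boldsymbol a=\boldsymbol 0$, $R\boldsymbol u=\boldsymbol u$; $\|\boldsymbol j-\frac1q\boldsymbol d\times\boldsymbol p\|=\ell$. Moreover, for every $E\in\mathbb R$, extending the elements of $\mathfrak b^*$ to $\mathfrak g^*$ by the value $E$ on $H$ and $0$ on $W$ induces a bijection from the set of coadjoint orbits of the Bargmann group $B$ in $\mathfrak b^*$ onto the set of coadjoint orbits of $G$ which consist of moments with $c=0$ and energy $E$. -/

import Mathlib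

open scoped Matrix Quaternion

noncomputable section

namespace Planon

/-! ### Euclidean three-space and the spin group -/

/-- Vectors of `ℝ³`; dot and cross products are Mathlib's `⬝ᵥ` and `⨯₃`. -/
abbrev V3 : Type := Fin 3 → ℝ

/-- The Euclidean length of a vector of `ℝ³`. -/
def len (v : V3) : ℝ := Real.sqrt (v ⬝ᵥ v)

/-- `Spin(3)`, the simply-connected double cover of `SO(3)`, realised as the unit quaternions. -/
abbrev Spin3 : Type := unitary ℍ[ℝ]

/-- The purely imaginary quaternion with given vector part. -/
def toIm (v : V3) : ℍ[ℝ] := ⟨0, v 0, v 1, v 2⟩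

/-- The vector part of a quaternion. -/
def ofIm (q : ℍ[ℝ]) : V3 := ![q.imI, q.imJ, q.imK]

/-- The map `v ↦ q v q̄` on vectors, for any quaternion `q`. -/
def qrot (q : ℍ[ℝ]) (v : V3) : V3 := ofIm (q * toIm v * star q)

@[simp] theorem toIm_re (v : V3) : (toIm v).re = 0 := rfl
@[simp] theorem toIm_imI (v : V3) : (toIm v).imI = v 0 := rfl
@[simp] theorem toIm_imJ (v : V3) : (toIm v).imJ = v 1 := rfl
@[simp] theorem toIm_imK (v : V3) : (toIm v).imK = v 2 := rfl

theorem qrot_zero (q : ℍ[ℝ]) (v : V3) : qrot q v 0 =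
    (q.re ^ 2 + q.imI ^ 2 - q.imJ ^ 2 - q.imK ^ 2) * v 0
      + 2 * (q.imI * q.imJ - q.re * q.imK) * v 1 + 2 * (q.imI * q.imK + q.re * q.imJ) * v 2 := by
  simp [qrot, ofIm, Quaternion.re_mul, Quaternion.imI_mul, Quaternion.imJ_mul, Quaternion.imK_mul]
  ring

theorem qrot_one (q : ℍ[ℝ]) (v : V3) : qrot q v 1 =
    2 * (q.imI * q.imJ + q.re * q.imK) * v 0
      + (q.re ^ 2 - q.imI ^ 2 + q.imJ ^ 2 - q.imK ^ 2) * v 1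
      + 2 * (q.imJ * q.imK - q.re * q.imI) * v 2 := by
  simp [qrot, ofIm, Quaternion.re_mul, Quaternion.imI_mul, Quaternion.imJ_mul, Quaternion.imK_mul]
  ring

theorem qrot_two (q : ℍ[ℝ]) (v : V3) : qrot q v 2 =
    2 * (q.imI * q.imK - q.re * q.imJ) * v 0 + 2 * (q.imJ * q.imK + q.re * q.imI) * v 1
      + (q.re ^ 2 - q.imI ^ 2 - q.imJ ^ 2 + q.imK ^ 2) * v 2 := by
  simp [qrot, ofIm, Quaternion.re_mul, Quaternion.imI_mul, Quaternion.imJ_mul, Quaternion.imK_mul]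
  ring

theorem cross_zero (v w : V3) : (v ⨯₃ w) 0 = v 1 * w 2 - v 2 * w 1 := by simp [cross_apply]
theorem cross_one (v w : V3) : (v ⨯₃ w) 1 = v 2 * w 0 - v 0 * w 2 := by simp [cross_apply]
theorem cross_two (v w : V3) : (v ⨯₃ w) 2 = v 0 * w 1 - v 1 * w 0 := by simp [cross_apply]

theorem dot_eq (v w : V3) : v ⬝ᵥ w = v 0 * w 0 + v 1 * w 1 + v 2 * w 2 := by
  simp [dotProduct, Fin.sum_univ_three]

/-- The rotation of `ℝ³` by an element of `Spin(3)`. -/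
def rot (R : Spin3) : V3 →ₗ[ℝ] V3 where
  toFun v := qrot R v
  map_add' v w := by
    ext i; fin_cases i <;> simp [qrot_zero, qrot_one, qrot_two] <;> ring
  map_smul' t v := by
    ext i; fin_cases i <;> simp [qrot_zero, qrot_one, qrot_two] <;> ring

theorem rot_def (R : Spin3) (v : V3) : rot R v = qrot R v := rfl

theorem Spin3.sq_sum (R : Spin3) :
    (R : ℍ[ℝ]).re ^ 2 + (R : ℍ[ℝ]).imI ^ 2 + (R : ℍ[ℝ]).imJ ^ 2 + (R : ℍ[ℝ]).imK ^ 2 = 1 := by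
  have h : ((R : ℍ[ℝ]) * star (R : ℍ[ℝ])).re = (1 : ℍ[ℝ]).re := by
    rw [Unitary.mul_star_self_of_mem R.2]
  rw [Quaternion.re_mul] at h
  simp only [Quaternion.re_star, Quaternion.imI_star, Quaternion.imJ_star, Quaternion.imK_star,
    Quaternion.re_one] at h
  linarith

theorem qrot_mul (q r : ℍ[ℝ]) (v : V3) : qrot (q * r) v = qrot q (qrot r v) := by
  ext i
  fin_cases i <;> simp [qrot_zero, qrot_one, qrot_two, Quaternion.re_mul, Quaternion.imI_mul,
    Quaternion.imJ_mul, Quaternion.imK_mul] <;> ring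

@[simp] theorem rot_one (v : V3) : rot 1 v = v := by
  ext i; fin_cases i <;> simp [rot_def, qrot_zero, qrot_one, qrot_two]

@[simp] theorem rot_mul (R S : Spin3) (v : V3) : rot (R * S) v = rot R (rot S v) := by
  simp [rot_def, qrot_mul]

@[simp] theorem rot_inv_rot (R : Spin3) (v : V3) : rot R⁻¹ (rot R v) = v := by
  rw [← rot_mul]; simp

@[simp] theorem rot_rot_inv (R : Spin3) (v : V3) : rot R (rot R⁻¹ v) = v := by
  rw [← rot_mul]; simp

theorem rot_dot (R : Spin3) (v w : V3) : rot R v ⬝ᵥ rot R w = v ⬝ᵥ w := by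
  have h := R.sq_sum
  have : rot R v ⬝ᵥ rot R w = ((R : ℍ[ℝ]).re ^ 2 + (R : ℍ[ℝ]).imI ^ 2 + (R : ℍ[ℝ]).imJ ^ 2
      + (R : ℍ[ℝ]).imK ^ 2) ^ 2 * (v ⬝ᵥ w) := by
    simp [rot_def, dot_eq, qrot_zero, qrot_one, qrot_two]; ring
  rw [this, h]; ring

theorem rot_cross (R : Spin3) (v w : V3) : rot R (v ⨯₃ w) = rot R v ⨯₃ rot R w := by
  have h := R.sq_sum
  have : rot R v ⨯₃ rot R w = ((R : ℍ[ℝ]).re ^ 2 + (R : ℍ[ℝ]).imI ^ 2 + (R : ℍ[ℝ]).imJ ^ 2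
      + (R : ℍ[ℝ]).imK ^ 2) • rot R (v ⨯₃ w) := by
    ext i
    fin_cases i <;> simp [rot_def, cross_zero, cross_one, cross_two, qrot_zero, qrot_one,
      qrot_two] <;> ring
  rw [this, h, one_smul]

/-! ### The centrally extended planon algebra -/

/-- The element `L(l) + P(x) + D(y) + Q·Q + Z·Z + H·H + W·W` of the centrally extended planon
algebra `𝔤` for `n = 3`. Here `P(x) = ∑ xₐ Pₐ`, `D(y) = ∑ yₐ Dₐ`, and `L(l) = ½ ε(l)_{ab} L_{ab}`
with `ε(l) v = l × v`, so that `[L(l), P(x)] = P(l × x)` and so on. -/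
@[ext] structure Alg where
  L : V3
  P : V3
  D : V3
  Q : ℝ
  Z : ℝ
  H : ℝ
  W : ℝ

namespace Alg

instance : Zero Alg := ⟨⟨0, 0, 0, 0, 0, 0, 0⟩⟩
instance : Add Alg := ⟨fun X Y =>
  ⟨X.L + Y.L, X.P + Y.P, X.D + Y.D, X.Q + Y.Q, X.Z + Y.Z, X.H + Y.H, X.W + Y.W⟩⟩
instance : Neg Alg := ⟨fun X => ⟨-X.L, -X.P, -X.D, -X.Q, -X.Z, -X.H, -X.W⟩⟩
instance : SMul ℝ Alg := ⟨fun t X =>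
  ⟨t • X.L, t • X.P, t • X.D, t * X.Q, t * X.Z, t * X.H, t * X.W⟩⟩

/-- The Lie bracket, whose nonzero components are
`[L, L] = L`, `[L, P] = P`, `[L, D] = D` (cross products),
`[Pₐ, Z] = Dₐ`, `[Pₐ, D_b] = δ_{ab} Q` and `[H, Z] = W`. -/
instance : Bracket Alg Alg := ⟨fun X Y =>
  { L := X.L ⨯₃ Y.L
    P := X.L ⨯₃ Y.P - Y.L ⨯₃ X.P
    D := X.L ⨯₃ Y.D - Y.L ⨯₃ X.D + Y.Z • X.P - X.Z • Y.P
    Q := X.P ⬝ᵥ Y.D - Y.P ⬝ᵥ X.D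
    Z := 0
    H := 0
    W := X.H * Y.Z - Y.H * X.Z }⟩

@[simp] theorem zero_L : (0 : Alg).L = 0 := rfl
@[simp] theorem zero_P : (0 : Alg).P = 0 := rfl
@[simp] theorem zero_D : (0 : Alg).D = 0 := rfl
@[simp] theorem zero_Q : (0 : Alg).Q = 0 := rfl
@[simp] theorem zero_Z : (0 : Alg).Z = 0 := rfl
@[simp] theorem zero_H : (0 : Alg).H = 0 := rfl
@[simp] theorem zero_W : (0 : Alg).W = 0 := rfl
@[simp] theorem add_L (X Y : Alg) : (X + Y).L = X.L + Y.L := rfl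
@[simp] theorem add_P (X Y : Alg) : (X + Y).P = X.P + Y.P := rfl
@[simp] theorem add_D (X Y : Alg) : (X + Y).D = X.D + Y.D := rfl
@[simp] theorem add_Q (X Y : Alg) : (X + Y).Q = X.Q + Y.Q := rfl
@[simp] theorem add_Z (X Y : Alg) : (X + Y).Z = X.Z + Y.Z := rfl
@[simp] theorem add_H (X Y : Alg) : (X + Y).H = X.H + Y.H := rfl
@[simp] theorem add_W (X Y : Alg) : (X + Y).W = X.W + Y.W := rfl
@[simp] theorem neg_L (X : Alg) : (-X).L = -X.L := rfl
@[simp] theorem neg_P (X : Alg) : (-X).P = -X.P := rfl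
@[simp] theorem neg_D (X : Alg) : (-X).D = -X.D := rfl
@[simp] theorem neg_Q (X : Alg) : (-X).Q = -X.Q := rfl
@[simp] theorem neg_Z (X : Alg) : (-X).Z = -X.Z := rfl
@[simp] theorem neg_H (X : Alg) : (-X).H = -X.H := rfl
@[simp] theorem neg_W (X : Alg) : (-X).W = -X.W := rfl
@[simp] theorem smul_L (t : ℝ) (X : Alg) : (t • X).L = t • X.L := rfl
@[simp] theorem smul_P (t : ℝ) (X : Alg) : (t • X).P = t • X.P := rfl
@[simp] theorem smul_D (t : ℝ) (X : Alg) : (t • X).D = t • X.D := rfl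
@[simp] theorem smul_Q (t : ℝ) (X : Alg) : (t • X).Q = t * X.Q := rfl
@[simp] theorem smul_Z (t : ℝ) (X : Alg) : (t • X).Z = t * X.Z := rfl
@[simp] theorem smul_H (t : ℝ) (X : Alg) : (t • X).H = t * X.H := rfl
@[simp] theorem smul_W (t : ℝ) (X : Alg) : (t • X).W = t * X.W := rfl
@[simp] theorem lie_L (X Y : Alg) : ⁅X, Y⁆.L = X.L ⨯₃ Y.L := rfl
@[simp] theorem lie_P (X Y : Alg) : ⁅X, Y⁆.P = X.L ⨯₃ Y.P - Y.L ⨯₃ X.P := rfl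
@[simp] theorem lie_D (X Y : Alg) :
    ⁅X, Y⁆.D = X.L ⨯₃ Y.D - Y.L ⨯₃ X.D + Y.Z • X.P - X.Z • Y.P := rfl
@[simp] theorem lie_Q (X Y : Alg) : ⁅X, Y⁆.Q = X.P ⬝ᵥ Y.D - Y.P ⬝ᵥ X.D := rfl
@[simp] theorem lie_Z (X Y : Alg) : ⁅X, Y⁆.Z = 0 := rfl
@[simp] theorem lie_H (X Y : Alg) : ⁅X, Y⁆.H = 0 := rfl
@[simp] theorem lie_W (X Y : Alg) : ⁅X, Y⁆.W = X.H * Y.Z - Y.H * X.Z := rfl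

instance : AddCommGroup Alg where
  add_assoc X Y Z := by ext <;> simp [add_assoc]
  zero_add X := by ext <;> simp
  add_zero X := by ext <;> simp
  add_comm X Y := by ext <;> simp [add_comm]
  neg_add_cancel X := by ext <;> simp
  nsmul := nsmulRec
  zsmul := zsmulRec

instance : Module ℝ Alg where
  one_smul X := by ext <;> simp
  mul_smul s t X := by ext <;> simp [mul_assoc]
  smul_zero t := by ext <;> simp
  smul_add t X Y := by ext <;> simp [mul_add]
  add_smul s t X := by ext <;> simp [add_mul]
  zero_smul X := by ext <;> simp

instance : LieRing Alg where
  add_lie X Y Z := by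
    ext i <;> (try fin_cases i) <;>
      simp [cross_zero, cross_one, cross_two, dot_eq] <;> ring
  lie_add X Y Z := by
    ext i <;> (try fin_cases i) <;>
      simp [cross_zero, cross_one, cross_two, dot_eq] <;> ring
  lie_self X := by
    ext i <;> (try fin_cases i) <;>
      simp [cross_zero, cross_one, cross_two, dot_eq] <;> ring
  leibniz_lie X Y Z := by
    ext i <;> (try fin_cases i) <;>
      simp [cross_zero, cross_one, cross_two, dot_eq] <;> ring

instance : LieAlgebra ℝ Alg where
  lie_smul t X Y := by
    ext i <;> (try fin_cases i) <;>
      simp [cross_zero, cross_one, cross_two, dot_eq] <;> ring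

/-- The underlying vector space of `𝔤` in coordinates. -/
def coords : Alg ≃ₗ[ℝ] V3 × V3 × V3 × ℝ × ℝ × ℝ × ℝ where
  toFun X := (X.L, X.P, X.D, X.Q, X.Z, X.H, X.W)
  invFun v := ⟨v.1, v.2.1, v.2.2.1, v.2.2.2.1, v.2.2.2.2.1, v.2.2.2.2.2.1, v.2.2.2.2.2.2⟩
  map_add' _ _ := rfl
  map_smul' _ _ := rfl
  left_inv _ := rfl
  right_inv _ := rfl

instance : Module.Finite ℝ Alg := Module.Finite.equiv coords.symm

theorem finrank_eq : Module.finrank ℝ Alg = 13 := by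
  rw [LinearEquiv.finrank_eq coords]; simp

end Alg

/-! ### The centrally extended planon group -/

/-- The (connected, simply-connected) centrally extended planon group `G` for `n = 3`, in the
global coordinates
`g(φ, φt, β, a, R, s, w) = exp(φ Q + φt Z) exp(β·D) exp(a·P) R exp(s H + w W)`. -/
@[ext] structure Grp where
  φ : ℝ
  φt : ℝ
  β : V3
  a : V3
  R : Spin3
  s : ℝ
  w : ℝ

namespace Grp

instance : One Grp := ⟨⟨0, 0, 0, 0, 1, 0, 0⟩⟩

/-- The group law, obtained by reordering the product of exponentials with the brackets. -/
instance : Mul Grp := ⟨fun g h =>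
  { φ := g.φ + h.φ + h.φt * (g.a ⬝ᵥ g.a) / 2 + g.a ⬝ᵥ rot g.R h.β
    φt := g.φt + h.φt
    β := g.β + rot g.R h.β + h.φt • g.a
    a := g.a + rot g.R h.a
    R := g.R * h.R
    s := g.s + h.s
    w := g.w + h.w + g.s * h.φt }⟩

instance : Inv Grp := ⟨fun g =>
  { φ := -g.φ + g.a ⬝ᵥ g.β - g.φt * (g.a ⬝ᵥ g.a) / 2
    φt := -g.φt
    β := rot g.R⁻¹ (-g.β + g.φt • g.a)
    a := rot g.R⁻¹ (-g.a)
    R := g.R⁻¹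
    s := -g.s
    w := -g.w + g.s * g.φt }⟩

@[simp] theorem one_φ : (1 : Grp).φ = 0 := rfl
@[simp] theorem one_φt : (1 : Grp).φt = 0 := rfl
@[simp] theorem one_β : (1 : Grp).β = 0 := rfl
@[simp] theorem one_a : (1 : Grp).a = 0 := rfl
@[simp] theorem one_R : (1 : Grp).R = 1 := rfl
@[simp] theorem one_s : (1 : Grp).s = 0 := rfl
@[simp] theorem one_w : (1 : Grp).w = 0 := rfl
@[simp] theorem mul_φ (g h : Grp) : (g * h).φ =
    g.φ + h.φ + h.φt * (g.a ⬝ᵥ g.a) / 2 + g.a ⬝ᵥ rot g.R h.β := rfl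
@[simp] theorem mul_φt (g h : Grp) : (g * h).φt = g.φt + h.φt := rfl
@[simp] theorem mul_β (g h : Grp) : (g * h).β = g.β + rot g.R h.β + h.φt • g.a := rfl
@[simp] theorem mul_a (g h : Grp) : (g * h).a = g.a + rot g.R h.a := rfl
@[simp] theorem mul_R (g h : Grp) : (g * h).R = g.R * h.R := rfl
@[simp] theorem mul_s (g h : Grp) : (g * h).s = g.s + h.s := rfl
@[simp] theorem mul_w (g h : Grp) : (g * h).w = g.w + h.w + g.s * h.φt := rfl
@[simp] theorem inv_φ (g : Grp) :
    g⁻¹.φ = -g.φ + g.a ⬝ᵥ g.β - g.φt * (g.a ⬝ᵥ g.a) / 2 := rfl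
@[simp] theorem inv_φt (g : Grp) : g⁻¹.φt = -g.φt := rfl
@[simp] theorem inv_β (g : Grp) : g⁻¹.β = rot g.R⁻¹ (-g.β + g.φt • g.a) := rfl
@[simp] theorem inv_a (g : Grp) : g⁻¹.a = rot g.R⁻¹ (-g.a) := rfl
@[simp] theorem inv_R (g : Grp) : g⁻¹.R = g.R⁻¹ := rfl
@[simp] theorem inv_s (g : Grp) : g⁻¹.s = -g.s := rfl
@[simp] theorem inv_w (g : Grp) : g⁻¹.w = -g.w + g.s * g.φt := rfl

instance : Group Grp := Group.ofLeftAxioms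
  (by
    intro g h k
    ext1
    · simp [rot_dot, dotProduct_comm h.a]
      rw [dotProduct_comm (rot g.R h.a) g.a]
      ring
    · simp [add_assoc]
    · simp only [mul_β, mul_φt, mul_R, rot_mul, map_add, map_smul, mul_a, add_smul, smul_add]
      abel
    · simp [add_assoc]
    · simp [mul_assoc]
    · simp [add_assoc]
    · simp; ring)
  (by intro g; ext1 <;> simp)
  (by
    intro g
    ext1
    · simp only [mul_φ, inv_φ, inv_a, inv_R, rot_dot, one_φ, neg_dotProduct, dotProduct_neg]
      ring
    · simp
    · simp
    · simp
    · simp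
    · simp
    · simp)

end Grp

/-! ### Adjoint and coadjoint action -/

theorem exp_toIm_mem (v : V3) : NormedSpace.exp (toIm v) ∈ unitary ℍ[ℝ] := by
  let _ : NormedAlgebra ℚ ℍ[ℝ] := NormedAlgebra.restrictScalars ℚ ℝ _
  apply NormedSpace.exp_mem_unitary_of_mem_skewAdjoint
  rw [skewAdjoint.mem_iff]
  ext <;> simp

/-- The element of `Spin(3)` covering the rotation with rotation vector `v`. -/
def spinExp (v : V3) : Spin3 := ⟨NormedSpace.exp (toIm ((1 / 2 : ℝ) • v)), exp_toIm_mem _⟩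

/-- A smooth curve in `G` with value `1` and velocity `X` at time `0`. -/
def curve (X : Alg) (t : ℝ) : Grp :=
  { φ := t * X.Q, φt := t * X.Z, β := t • X.D, a := t • X.P, R := spinExp (t • X.L),
    s := t * X.H, w := t * X.W }

/-- The velocity at time `0` of a curve in `G` which passes through `1` at time `0`,
as an element of the Lie algebra `𝔤 = T₁G`. -/
def velocity (γ : ℝ → Grp) : Alg :=
  { L := deriv (fun t => (2 : ℝ) • ofIm ((γ t).R : ℍ[ℝ])) 0
    P := deriv (fun t => (γ t).a) 0
    D := deriv (fun t => (γ t).β) 0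
    Q := deriv (fun t => (γ t).φ) 0
    Z := deriv (fun t => (γ t).φt) 0
    H := deriv (fun t => (γ t).s) 0
    W := deriv (fun t => (γ t).w) 0 }

/-- The adjoint action `Ad_g X = d/dt (g γ(t) g⁻¹)` at `t = 0`, where `γ` is a curve through
`1` with velocity `X`. -/
def adj (g : Grp) (X : Alg) : Alg := velocity (fun t => g * curve X t * g⁻¹)

theorem curve_zero (X : Alg) : curve X 0 = 1 := by
  ext1 <;> simp [curve]
  ext1
  simp [spinExp, show toIm 0 = 0 from by ext <;> simp]

theorem hasDerivAt_spin (v : V3) :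
    HasDerivAt (fun t : ℝ => ((spinExp (t • v) : Spin3) : ℍ[ℝ])) (toIm ((1 / 2 : ℝ) • v)) 0 := by
  have h := hasDerivAt_exp_smul_const (𝕂 := ℝ) (toIm ((1 / 2 : ℝ) • v)) (0 : ℝ)
  rw [zero_smul, NormedSpace.exp_zero, one_mul] at h
  refine h.congr_of_eventuallyEq (Filter.Eventually.of_forall fun t => ?_)
  change NormedSpace.exp _ = NormedSpace.exp _
  congr 1
  ext <;> simp <;> ring

/-- `q ↦ ofIm q` as a linear map. -/
def ofImL : ℍ[ℝ] →ₗ[ℝ] V3 where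
  toFun := ofIm
  map_add' p q := by ext i; fin_cases i <;> simp [ofIm]
  map_smul' t q := by ext i; fin_cases i <;> simp [ofIm]

theorem hasDerivAt_ofIm {q : ℝ → ℍ[ℝ]} {q' : ℍ[ℝ]} (h : HasDerivAt q q' 0) :
    HasDerivAt (fun t => ofIm (q t)) (ofIm q') 0 :=
  ofImL.toContinuousLinearMap.hasFDerivAt.comp_hasDerivAt (0 : ℝ) h

/-- Quaternion conjugation as a real linear map. -/
def starL : ℍ[ℝ] →ₗ[ℝ] ℍ[ℝ] where
  toFun := star
  map_add' p q := star_add p q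
  map_smul' t q := by ext <;> simp

theorem hasDerivAt_star {q : ℝ → ℍ[ℝ]} {q' : ℍ[ℝ]} (h : HasDerivAt q q' 0) :
    HasDerivAt (fun t => star (q t)) (star q') 0 :=
  starL.toContinuousLinearMap.hasFDerivAt.comp_hasDerivAt (0 : ℝ) h

theorem hasDerivAt_rot_lin (R : Spin3) {v : ℝ → V3} {v' : V3} (h : HasDerivAt v v' 0) :
    HasDerivAt (fun t => rot R (v t)) (rot R v') 0 :=
  (rot R).toContinuousLinearMap.hasFDerivAt.comp_hasDerivAt (0 : ℝ) h

theorem hasDerivAt_rot_spin (l v : V3) :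
    HasDerivAt (fun t : ℝ => rot (spinExp (t • l)) v) (l ⨯₃ v) 0 := by
  have h := hasDerivAt_spin l
  have h0 : ((spinExp ((0 : ℝ) • l) : Spin3) : ℍ[ℝ]) = 1 := by
    have := congrArg (fun g : Grp => (g.R : ℍ[ℝ])) (curve_zero ⟨l, 0, 0, 0, 0, 0, 0⟩)
    simpa [curve] using this
  have h2 := (h.mul_const (toIm v)).mul (hasDerivAt_star h)
  have h3 := hasDerivAt_ofIm h2
  refine h3.congr_deriv ?_
  rw [h0]
  ext i
  fin_cases i <;> simp [ofIm, Quaternion.imI_mul,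
    Quaternion.imJ_mul, Quaternion.imK_mul, cross_zero, cross_one, cross_two] <;> ring

theorem hasDerivAt_dot {v w : ℝ → V3} {v' w' : V3} {t : ℝ} (hv : HasDerivAt v v' t)
    (hw : HasDerivAt w w' t) :
    HasDerivAt (fun t => v t ⬝ᵥ w t) (v' ⬝ᵥ w t + v t ⬝ᵥ w') t := by
  have hv' := hasDerivAt_pi.1 hv
  have hw' := hasDerivAt_pi.1 hw
  simp only [dot_eq]
  refine ((((hv' 0).mul (hw' 0)).add ((hv' 1).mul (hw' 1))).add
    ((hv' 2).mul (hw' 2))).congr_deriv ?_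
  ring

theorem rot_spin_zero (v : V3) : rot (spinExp 0) v = v := by
  have := congrArg (fun g : Grp => rot g.R v) (curve_zero 0)
  simpa [curve] using this

/-- The adjoint action in closed form. -/
theorem adj_eq (g : Grp) (X : Alg) : adj g X =
    { L := rot g.R X.L
      P := rot g.R X.P + g.a ⨯₃ rot g.R X.L
      D := rot g.R X.D + X.Z • g.a + g.β ⨯₃ rot g.R X.L
        - g.φt • (rot g.R X.P + g.a ⨯₃ rot g.R X.L)
      Q := X.Q + g.a ⬝ᵥ rot g.R X.D + X.Z * (g.a ⬝ᵥ g.a) / 2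
        - g.β ⬝ᵥ (rot g.R X.P + g.a ⨯₃ rot g.R X.L)
      Z := X.Z
      H := X.H
      W := X.W + g.s * X.Z - g.φt * X.H } := by
  have hid : HasDerivAt (fun t : ℝ => t) 1 0 := hasDerivAt_id 0
  have hP : HasDerivAt (fun t : ℝ => rot g.R (t • X.P)) (rot g.R X.P) 0 :=
    hasDerivAt_rot_lin _ ((hid.smul_const X.P).congr_deriv (by simp))
  have hD : HasDerivAt (fun t : ℝ => rot g.R (t • X.D)) (rot g.R X.D) 0 :=
    hasDerivAt_rot_lin _ ((hid.smul_const X.D).congr_deriv (by simp))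
  have hR : ∀ v : V3, HasDerivAt (fun t : ℝ => rot g.R (rot (spinExp (t • X.L)) (rot g.R⁻¹ v)))
      (rot g.R X.L ⨯₃ v) 0 := by
    intro v
    refine (hasDerivAt_rot_lin _ (hasDerivAt_rot_spin X.L (rot g.R⁻¹ v))).congr_deriv ?_
    rw [rot_cross, rot_rot_inv]
  have hZ : HasDerivAt (fun t : ℝ => t * X.Z) X.Z 0 := by simpa using hid.mul_const X.Z
  have hH : HasDerivAt (fun t : ℝ => t * X.H) X.H 0 := by simpa using hid.mul_const X.H
  have hW : HasDerivAt (fun t : ℝ => t * X.W) X.W 0 := by simpa using hid.mul_const X.W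
  have hQ : HasDerivAt (fun t : ℝ => t * X.Q) X.Q 0 := by simpa using hid.mul_const X.Q
  have hA : HasDerivAt (fun t : ℝ => g.a + rot g.R (t • X.P)) (rot g.R X.P) 0 := hP.const_add _
  ext1
  · apply HasDerivAt.deriv
    have h := ((hasDerivAt_spin X.L).const_mul (g.R : ℍ[ℝ])).mul_const ((g.R⁻¹ : Spin3) : ℍ[ℝ])
    refine ((hasDerivAt_ofIm h).const_smul (2 : ℝ)).congr_deriv ?_
    change (2 : ℝ) • ofImL _ = qrot g.R X.L
    rw [← map_smul]
    change ofIm _ = ofIm _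
    congr 1
    rw [← smul_mul_assoc, ← mul_smul_comm]
    congr 2
    ext <;> simp
  · apply HasDerivAt.deriv
    have h := hA.add (hR (-g.a))
    simp only [curve, Grp.mul_a, Grp.inv_a, Grp.mul_R, rot_mul]
    refine h.congr_deriv ?_
    rw [map_neg, cross_anticomm]
  · apply HasDerivAt.deriv
    have h := ((hD.const_add g.β).add (hZ.smul_const g.a)).add (hR (-g.β + g.φt • g.a))
    have h2 := h.add (hA.const_smul (-g.φt))
    simp only [curve, Grp.mul_a, Grp.inv_β, Grp.inv_φt, Grp.mul_R, Grp.mul_β, rot_mul]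
    refine h2.congr_deriv ?_
    rw [← cross_anticomm]
    simp only [map_add, map_neg, map_smul, LinearMap.add_apply, LinearMap.neg_apply,
      LinearMap.smul_apply]
    module
  · apply HasDerivAt.deriv
    simp only [curve, Grp.mul_a, Grp.inv_φt, Grp.inv_φ, Grp.inv_β, Grp.mul_φ, Grp.mul_R, rot_mul]
    have h1 := ((hQ.const_add g.φ).add ((hZ.mul_const (g.a ⬝ᵥ g.a)).div_const 2)).add
      (hasDerivAt_dot (hasDerivAt_const (0 : ℝ) g.a) hD)
    have h2 := (h1.add_const (-g.φ + g.a ⬝ᵥ g.β - g.φt * (g.a ⬝ᵥ g.a) / 2)).add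
      (((hasDerivAt_dot hA hA).const_mul (-g.φt)).div_const 2)
    have h3 := h2.add (hasDerivAt_dot hA (hR (-g.β + g.φt • g.a)))
    refine h3.congr_deriv ?_
    rw [zero_smul, zero_smul, zero_smul, rot_spin_zero, rot_rot_inv, map_zero, add_zero]
    simp [dot_eq, cross_zero, cross_one, cross_two]
    ring
  · apply HasDerivAt.deriv
    exact (hZ.const_add g.φt).add_const (-g.φt)
  · apply HasDerivAt.deriv
    exact (hH.const_add g.s).add_const (-g.s)
  · apply HasDerivAt.deriv
    have h1 := (((hW.const_add g.w).add (hZ.const_mul g.s)).add_const (-g.w + g.s * g.φt)).add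
      ((hH.const_add g.s).mul_const (-g.φt))
    refine h1.congr_deriv ?_
    ring

/-- The Lie bracket is the derivative of the adjoint action at the identity: the bracket of `𝔤`
is the one determined by the group `G`. -/
theorem hasDerivAt_adj (X Y : Alg) : velocity (curve X) = X ∧
    HasDerivAt (fun t => (adj (curve X t) Y).L) ⁅X, Y⁆.L 0 ∧
    HasDerivAt (fun t => (adj (curve X t) Y).P) ⁅X, Y⁆.P 0 ∧
    HasDerivAt (fun t => (adj (curve X t) Y).D) ⁅X, Y⁆.D 0 ∧
    HasDerivAt (fun t => (adj (curve X t) Y).Q) ⁅X, Y⁆.Q 0 ∧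
    HasDerivAt (fun t => (adj (curve X t) Y).Z) ⁅X, Y⁆.Z 0 ∧
    HasDerivAt (fun t => (adj (curve X t) Y).H) ⁅X, Y⁆.H 0 ∧
    HasDerivAt (fun t => (adj (curve X t) Y).W) ⁅X, Y⁆.W 0 := by
  have hid : HasDerivAt (fun t : ℝ => t) 1 0 := hasDerivAt_id 0
  have hs : ∀ x : ℝ, HasDerivAt (fun t : ℝ => t * x) x 0 := fun x => by
    simpa using hid.mul_const x
  have hv : ∀ x : V3, HasDerivAt (fun t : ℝ => t • x) x 0 := fun x => by
    simpa using hid.smul_const x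
  have hR := hasDerivAt_rot_spin X.L
  have hc : ∀ {v w : ℝ → V3} {v' w' : V3}, HasDerivAt v v' 0 → HasDerivAt w w' 0 →
      HasDerivAt (fun t => v t ⨯₃ w t) (v' ⨯₃ w 0 + v 0 ⨯₃ w') 0 := by
    intro v w v' w' hv hw
    rw [hasDerivAt_pi] at hv hw ⊢
    intro i
    fin_cases i
    · simp only [Fin.zero_eta, cross_zero]
      refine (((hv 1).mul (hw 2)).sub ((hv 2).mul (hw 1))).congr_deriv ?_
      simp [cross_zero]; ring
    · simp only [Fin.mk_one, cross_one]
      refine (((hv 2).mul (hw 0)).sub ((hv 0).mul (hw 2))).congr_deriv ?_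
      simp [cross_one]; ring
    · simp only [Fin.reduceFinMk, cross_two]
      refine (((hv 0).mul (hw 1)).sub ((hv 1).mul (hw 0))).congr_deriv ?_
      simp [cross_two]; ring
  simp only [adj_eq, curve]
  refine ⟨?_, hR _, ?_, ?_, ?_, ?_, ?_, ?_⟩
  · ext1
    · apply HasDerivAt.deriv
      refine ((hasDerivAt_ofIm (hasDerivAt_spin X.L)).const_smul (2 : ℝ)).congr_deriv ?_
      ext i; fin_cases i <;> simp [ofIm]
    · exact (hv _).deriv
    · exact (hv _).deriv
    · exact (hs _).deriv
    · exact (hs _).deriv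
    · exact (hs _).deriv
    · exact (hs _).deriv
  · refine ((hR Y.P).add (hc (hv X.P) (hR Y.L))).congr_deriv ?_
    rw [zero_smul, zero_smul, rot_spin_zero, Alg.lie_P, sub_eq_add_neg, cross_anticomm Y.L]
    simp
  · refine (((hR Y.D).add ((hv X.P).const_smul Y.Z)).add (hc (hv X.D) (hR Y.L))).sub
      ((hs X.Z).smul ((hR Y.P).add (hc (hv X.P) (hR Y.L)))) |>.congr_deriv ?_
    simp only [zero_smul, rot_spin_zero, Alg.lie_D, Pi.add_apply, zero_mul]
    have h := cross_anticomm Y.L X.D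
    simp
    rw [← h]
    abel
  · refine (((hasDerivAt_dot (hv X.P) (hR Y.D)).const_add Y.Q).add
      (((hasDerivAt_dot (hv X.P) (hv X.P)).const_mul Y.Z).div_const 2)).sub
      (hasDerivAt_dot (hv X.D) ((hR Y.P).add (hc (hv X.P) (hR Y.L)))) |>.congr_deriv ?_
    simp only [zero_smul, rot_spin_zero, Alg.lie_Q, Pi.add_apply]
    rw [dotProduct_comm X.D]
    simp
  · exact hasDerivAt_const _ _
  · exact hasDerivAt_const _ _
  · refine ((((hs X.H).mul_const Y.Z).const_add Y.W).sub ((hs X.Z).mul_const Y.H)).congr_deriv ?_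
    simp; ring

theorem adj_mul (g h : Grp) (X : Alg) : adj (g * h) X = adj g (adj h X) := by
  simp only [adj_eq]
  ext1
  · simp
  · simp [rot_cross]
    abel
  · simp [rot_cross]
    module
  · have h1 := rot_dot g.R h.a (rot h.R X.D)
    have h2 := rot_dot g.R h.β (rot h.R X.P)
    have h3 := rot_dot g.R h.β (h.a ⨯₃ rot h.R X.L)
    have h4 := rot_dot g.R h.a h.a
    simp only [rot_cross] at h3
    simp only [Grp.mul_β, Grp.mul_a, Grp.mul_R, rot_mul, map_add, map_sub,
      map_smul, rot_cross]
    simp only [dotProduct_add, add_dotProduct, smul_dotProduct, dotProduct_smul, dotProduct_sub,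
      LinearMap.add_apply, smul_eq_mul, h1, h2, h3, h4]
    simp only [dot_eq, cross_zero, cross_one, cross_two]
    ring
  · simp
  · simp
  · simp; ring

theorem adj_one (X : Alg) : adj 1 X = X := by
  simp only [adj_eq]
  ext1 <;> simp

/-- The adjoint action of a group element as a linear map. -/
def Ad (g : Grp) : Alg →ₗ[ℝ] Alg where
  toFun := adj g
  map_add' X Y := by
    simp only [adj_eq]
    ext i <;> (try fin_cases i) <;>
      simp [cross_zero, cross_one, cross_two, dot_eq] <;> ring
  map_smul' t X := by
    simp only [adj_eq]
    ext i <;> (try fin_cases i) <;>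
      simp [cross_zero, cross_one, cross_two, dot_eq] <;> ring

@[simp] theorem Ad_apply (g : Grp) (X : Alg) : Ad g X = adj g X := rfl

/-- The dual space `𝔤*` of moments. -/
abbrev Mom : Type := Module.Dual ℝ Alg

/-- The coadjoint action `⟨Ad*_g α, X⟩ = ⟨α, Ad_{g⁻¹} X⟩` of `G` on `𝔤*`. -/
instance : MulAction Grp Mom where
  smul g α := α ∘ₗ Ad g⁻¹
  one_smul α := by
    ext X
    change α (adj 1⁻¹ X) = α X
    rw [inv_one, adj_one]
  mul_smul g h α := by
    ext X
    change α (adj (g * h)⁻¹ X) = α (adj h⁻¹ (adj g⁻¹ X))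
    rw [mul_inv_rev, adj_mul]

theorem coadj_apply (g : Grp) (α : Mom) (X : Alg) : (g • α) X = α (adj g⁻¹ X) := rfl

/-- The infinitesimal coadjoint action at `α`, `X ↦ ad*_X α`,
with `⟨ad*_X α, Y⟩ = -⟨α, [X, Y]⟩`. -/
def adStar (α : Mom) : Alg →ₗ[ℝ] Mom where
  toFun X := -(α ∘ₗ (LieAlgebra.ad ℝ Alg X : Alg →ₗ[ℝ] Alg))
  map_add' X Y := by ext Z; simp; ring
  map_smul' t X := by ext Z; simp

/-- The dimension of the coadjoint orbit of `α` at `α`: the dimension of its tangent space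
`T_α 𝒪 = {ad*_X α | X ∈ 𝔤}`. -/
def orbitDim (α : Mom) : ℕ := Module.finrank ℝ (LinearMap.range (adStar α))

/-- The moment `M(q, qt, d, p, j, E, c)`, i.e. the linear form with value `q` on `Q`, `qt` on `Z`,
`-d_a` on `D_a`, `p_a` on `P_a`, `j · l` on `L(l)`, `E` on `H` and `c` on `W`. -/
def mom (q qt : ℝ) (d p j : V3) (E c : ℝ) : Mom where
  toFun X := j ⬝ᵥ X.L + p ⬝ᵥ X.P - d ⬝ᵥ X.D + qt * X.Z + q * X.Q + E * X.H + c * X.W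
  map_add' X Y := by simp; ring
  map_smul' t X := by simp; ring

theorem mom_apply (q qt : ℝ) (d p j : V3) (E c : ℝ) (X : Alg) : mom q qt d p j E c X =
    j ⬝ᵥ X.L + p ⬝ᵥ X.P - d ⬝ᵥ X.D + qt * X.Z + q * X.Q + E * X.H + c * X.W := rfl

/-- Every moment is of the form `M(q, qt, d, p, j, E, c)`. -/
theorem exists_mom (α : Mom) : ∃ q qt d p j E c, α = mom q qt d p j E c := by
  refine ⟨α ⟨0, 0, 0, 1, 0, 0, 0⟩, α ⟨0, 0, 0, 0, 1, 0, 0⟩,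
    fun i => -α ⟨0, 0, Pi.single i 1, 0, 0, 0, 0⟩, fun i => α ⟨0, Pi.single i 1, 0, 0, 0, 0, 0⟩,
    fun i => α ⟨Pi.single i 1, 0, 0, 0, 0, 0, 0⟩, α ⟨0, 0, 0, 0, 0, 1, 0⟩,
    α ⟨0, 0, 0, 0, 0, 0, 1⟩, ?_⟩
  ext X
  have hX : X = X.L 0 • (⟨Pi.single 0 1, 0, 0, 0, 0, 0, 0⟩ : Alg)
      + X.L 1 • (⟨Pi.single 1 1, 0, 0, 0, 0, 0, 0⟩ : Alg)
      + X.L 2 • (⟨Pi.single 2 1, 0, 0, 0, 0, 0, 0⟩ : Alg)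
      + X.P 0 • (⟨0, Pi.single 0 1, 0, 0, 0, 0, 0⟩ : Alg)
      + X.P 1 • (⟨0, Pi.single 1 1, 0, 0, 0, 0, 0⟩ : Alg)
      + X.P 2 • (⟨0, Pi.single 2 1, 0, 0, 0, 0, 0⟩ : Alg)
      + X.D 0 • (⟨0, 0, Pi.single 0 1, 0, 0, 0, 0⟩ : Alg)
      + X.D 1 • (⟨0, 0, Pi.single 1 1, 0, 0, 0, 0⟩ : Alg)
      + X.D 2 • (⟨0, 0, Pi.single 2 1, 0, 0, 0, 0⟩ : Alg)
      + X.Q • (⟨0, 0, 0, 1, 0, 0, 0⟩ : Alg) + X.Z • (⟨0, 0, 0, 0, 1, 0, 0⟩ : Alg)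
      + X.H • (⟨0, 0, 0, 0, 0, 1, 0⟩ : Alg) + X.W • (⟨0, 0, 0, 0, 0, 0, 1⟩ : Alg) := by
    ext i <;> (try fin_cases i) <;> simp
  conv_lhs => rw [hX]
  simp only [map_add, map_smul, mom_apply, dot_eq, smul_eq_mul]
  ring

/-- The coadjoint action in coordinates. -/
theorem smul_mom (g : Grp) (q qt : ℝ) (d p j : V3) (E c : ℝ) :
    g • mom q qt d p j E c = mom q
      (qt + rot g.R d ⬝ᵥ g.a + q * (g.a ⬝ᵥ g.a) / 2 - c * g.s)
      (rot g.R d + q • g.a)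
      (rot g.R p + q • g.β - g.φt • (rot g.R d + q • g.a))
      (rot g.R j - g.β ⨯₃ (rot g.R d + q • g.a) + g.a ⨯₃ rot g.R p)
      (E + c * g.φt) c := by
  ext X
  rw [coadj_apply, adj_eq, mom_apply, mom_apply]
  have e : ∀ v w : V3, v ⬝ᵥ rot g.R⁻¹ w = rot g.R v ⬝ᵥ w := fun v w => by
    rw [← rot_dot g.R, rot_rot_inv]
  simp only [Grp.inv_a, Grp.inv_R, Grp.inv_β, Grp.inv_φt, Grp.inv_s, ← rot_cross, ← map_add,
    ← map_smul, ← map_sub, e]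
  simp [dot_eq, cross_zero, cross_one, cross_two]
  ring

/-! ### The Bargmann subgroup -/

/-- The Bargmann group `B`, the subgroup of the elements `b(φ, φt, β, a, R)` of `G`. -/
def bargmannGroup : Subgroup Grp where
  carrier := {g | g.s = 0 ∧ g.w = 0}
  mul_mem' := by
    rintro g h ⟨h1, h2⟩ ⟨h3, h4⟩
    simp [h1, h2, h3, h4]
  one_mem' := by simp
  inv_mem' := by
    rintro g ⟨h1, h2⟩
    simp [h1, h2]

/-- The abelian subgroup `A` of the elements `exp(s H + w W)` of `G`. -/
def abelianGroup : Subgroup Grp where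
  carrier := {g | g.φ = 0 ∧ g.φt = 0 ∧ g.β = 0 ∧ g.a = 0 ∧ g.R = 1}
  mul_mem' := by
    rintro g h ⟨h1, h2, h3, h4, h5⟩ ⟨k1, k2, k3, k4, k5⟩
    simp [h1, h2, h3, h4, h5, k1, k2, k3, k4, k5]
  one_mem' := by simp
  inv_mem' := by
    rintro g ⟨h1, h2, h3, h4, h5⟩
    simp [h1, h2, h3, h4, h5]

/-- The Bargmann algebra `𝔟`, the span of the `L`, `P`, `D`, `Q`, `Z`. -/
def bargmannAlg : LieSubalgebra ℝ Alg where
  carrier := {X | X.H = 0 ∧ X.W = 0}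
  add_mem' := by
    rintro X Y ⟨h1, h2⟩ ⟨h3, h4⟩
    simp [h1, h2, h3, h4]
  zero_mem' := by simp
  smul_mem' := by
    rintro t X ⟨h1, h2⟩
    simp [h1, h2]
  lie_mem' := by
    rintro X Y ⟨h1, h2⟩ ⟨h3, h4⟩
    simp [h1, h3]

theorem mem_bargmannAlg {X : Alg} : X ∈ bargmannAlg ↔ X.H = 0 ∧ X.W = 0 := Iff.rfl

/-- The adjoint action of the Bargmann group on its Lie algebra. -/
def bargmannAd (b : bargmannGroup) : bargmannAlg →ₗ[ℝ] bargmannAlg where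
  toFun X := ⟨Ad b X, by
    obtain ⟨⟨b, hs, hw⟩, X, hH, hW⟩ := b, X
    simp only at *
    rw [mem_bargmannAlg, Ad_apply, adj_eq]
    simp [hs, hH, hW]⟩
  map_add' X Y := Subtype.ext (by simp [map_add])
  map_smul' t X := Subtype.ext (by simp [map_smul])

/-- The coadjoint action of the Bargmann group on `𝔟*`. -/
instance : MulAction bargmannGroup (Module.Dual ℝ bargmannAlg) where
  smul b β := β ∘ₗ bargmannAd b⁻¹
  one_smul β := by
    ext X
    change β (bargmannAd 1⁻¹ X) = β X
    congr 1
    exact Subtype.ext (by simp [bargmannAd, adj_one])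
  mul_smul b c β := by
    ext X
    change β (bargmannAd (b * c)⁻¹ X) = β (bargmannAd c⁻¹ (bargmannAd b⁻¹ X))
    congr 1
    exact Subtype.ext (by simp [bargmannAd, adj_mul])

/-- The linear projection `𝔤 → 𝔟` with kernel `⟨H, W⟩`. -/
def bargmannProj : Alg →ₗ[ℝ] bargmannAlg where
  toFun X := ⟨⟨X.L, X.P, X.D, X.Q, X.Z, 0, 0⟩, rfl, rfl⟩
  map_add' X Y := Subtype.ext (by ext1 <;> simp)
  map_smul' t X := Subtype.ext (by ext1 <;> simp)

/-- The Bargmann moment `β` placed in `𝔤*` at the energy `E`: the moment which is `β` on `𝔟`,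
`E` on `H` and `0` on `W`. -/
def atEnergy (E : ℝ) (β : Module.Dual ℝ bargmannAlg) : Mom :=
  β ∘ₗ bargmannProj + mom 0 0 0 0 0 E 0

/-! ### The list of orbits -/

/-- The labels of the list of coadjoint orbits, with their parameters. Each prime of the
mathematical label is written `p`; the number is the dimension of the orbit. -/
inductive Row : Type
  | orb0 (qt₀ E₀ : ℝ)
  | orb2 (ℓ qt₀ E₀ : ℝ)
  | orb2p (c₀ : ℝ)
  | orb4 (p₀ h qt₀ E₀ : ℝ)
  | orb4p (ℓ c₀ : ℝ)
  | orb6 (q₀ qt₀ E₀ : ℝ)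
  | orb6p (d₀ h E₀ : ℝ)
  | orb6pp (p₀ h c₀ : ℝ)
  /-- The orbits of type `6'''₊` (for `σ = 1`) and `6'''₋` (for `σ = -1`). -/
  | orb6pppSigned (σ E₀ d₀ h c₀ : ℝ)
  /-- The orbits of type `6'''₀`. -/
  | orb6pppZero (d₀ h c₀ : ℝ)
  | orb8 (ℓ q₀ qt₀ E₀ : ℝ)
  | orb8p (d₀ p₀ E₀ : ℝ)
  | orb8pp (d₀ p₀ ε₀ c₀ : ℝ)
  /-- Here `r = q / c` is the nonzero ratio. -/
  | orb8ppp (r c₀ : ℝ)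
  /-- Here `r = q / c` is the nonzero ratio. -/
  | orb10 (ℓ r c₀ : ℝ)

namespace Row

/-- The range of the parameters. -/
def Admissible : Row → Prop
  | orb0 _ _ => True
  | orb2 ℓ _ _ => 0 < ℓ
  | orb2p c₀ => c₀ ≠ 0
  | orb4 p₀ _ _ _ => 0 < p₀
  | orb4p ℓ c₀ => 0 < ℓ ∧ c₀ ≠ 0
  | orb6 q₀ _ _ => q₀ ≠ 0
  | orb6p d₀ _ _ => 0 < d₀
  | orb6pp p₀ _ c₀ => 0 < p₀ ∧ c₀ ≠ 0
  | orb6pppSigned σ E₀ d₀ _ c₀ => (σ = 1 ∨ σ = -1) ∧ 0 < E₀ ∧ 0 < d₀ ∧ c₀ ≠ 0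
  | orb6pppZero d₀ _ c₀ => 0 < d₀ ∧ c₀ ≠ 0
  | orb8 ℓ q₀ _ _ => 0 < ℓ ∧ q₀ ≠ 0
  | orb8p d₀ p₀ _ => 0 < d₀ ∧ 0 < p₀
  | orb8pp d₀ p₀ _ c₀ => 0 < d₀ ∧ 0 < p₀ ∧ c₀ ≠ 0
  | orb8ppp r c₀ => r ≠ 0 ∧ c₀ ≠ 0
  | orb10 ℓ r c₀ => 0 < ℓ ∧ r ≠ 0 ∧ c₀ ≠ 0

/-- The dimension of the orbit. -/
def dim : Row → ℕ
  | orb0 _ _ => 0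
  | orb2 _ _ _ => 2
  | orb2p _ => 2
  | orb4 _ _ _ _ => 4
  | orb4p _ _ => 4
  | orb6 _ _ _ => 6
  | orb6p _ _ _ => 6
  | orb6pp _ _ _ => 6
  | orb6pppSigned _ _ _ _ _ => 6
  | orb6pppZero _ _ _ => 6
  | orb8 _ _ _ _ => 8
  | orb8p _ _ _ => 8
  | orb8pp _ _ _ _ => 8
  | orb8ppp _ _ => 8
  | orb10 _ _ _ => 10

/-- The orbit representative; `u` and `v` are perpendicular unit vectors. -/
def rep (u v : V3) : Row → Mom
  | orb0 qt₀ E₀ => mom 0 qt₀ 0 0 0 E₀ 0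
  | orb2 ℓ qt₀ E₀ => mom 0 qt₀ 0 0 (ℓ • u) E₀ 0
  | orb2p c₀ => mom 0 0 0 0 0 0 c₀
  | orb4 p₀ h qt₀ E₀ => mom 0 qt₀ 0 (p₀ • u) (h • u) E₀ 0
  | orb4p ℓ c₀ => mom 0 0 0 0 (ℓ • u) 0 c₀
  | orb6 q₀ qt₀ E₀ => mom q₀ qt₀ 0 0 0 E₀ 0
  | orb6p d₀ h E₀ => mom 0 0 (d₀ • u) 0 (h • u) E₀ 0
  | orb6pp p₀ h c₀ => mom 0 0 0 (p₀ • u) (h • u) 0 c₀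
  | orb6pppSigned σ E₀ d₀ h c₀ => mom 0 0 (d₀ • u) ((σ * (E₀ * d₀ / c₀)) • u) (h • u) 0 c₀
  | orb6pppZero d₀ h c₀ => mom 0 0 (d₀ • u) 0 (h • u) 0 c₀
  | orb8 ℓ q₀ qt₀ E₀ => mom q₀ qt₀ 0 0 (ℓ • u) E₀ 0
  | orb8p d₀ p₀ E₀ => mom 0 0 (d₀ • u) (p₀ • v) 0 E₀ 0
  | orb8pp d₀ p₀ ε₀ c₀ => mom 0 0 (d₀ • u) (p₀ • v + (ε₀ * d₀ / c₀) • u) 0 0 c₀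
  | orb8ppp r c₀ => mom (r * c₀) 0 0 0 0 0 c₀
  | orb10 ℓ r c₀ => mom (r * c₀) 0 0 0 (ℓ • u) 0 c₀

/-- The stabiliser of the orbit representative. -/
def stab (u v : V3) : Row → Set Grp
  | orb0 _ _ => Set.univ
  | orb2 _ _ _ => {g | rot g.R u = u}
  | orb2p _ => {g | g.φt = 0 ∧ g.s = 0}
  | orb4 _ _ _ _ => {g | rot g.R u = u ∧ ∃ x : ℝ, g.a = x • u}
  | orb4p _ _ => {g | g.φt = 0 ∧ g.s = 0 ∧ rot g.R u = u}
  | orb6 _ _ _ => {g | g.β = 0 ∧ g.a = 0}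
  | orb6p _ _ _ =>
      {g | g.φt = 0 ∧ rot g.R u = u ∧ (∃ x : ℝ, g.β = x • u) ∧ g.a ⬝ᵥ u = 0}
  | orb6pp _ _ _ => {g | g.φt = 0 ∧ g.s = 0 ∧ rot g.R u = u ∧ ∃ x : ℝ, g.a = x • u}
  | orb6pppSigned σ E₀ d₀ _ c₀ =>
      {g | g.φt = 0 ∧ g.s = d₀ * (g.a ⬝ᵥ u) / c₀ ∧ rot g.R u = u ∧
        (d₀ • g.β - (σ * (E₀ * d₀ / c₀)) • g.a) ⨯₃ u = 0}
  | orb6pppZero d₀ _ c₀ =>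
      {g | g.φt = 0 ∧ g.s = d₀ * (g.a ⬝ᵥ u) / c₀ ∧ rot g.R u = u ∧ (d₀ • g.β) ⨯₃ u = 0}
  | orb8 _ _ _ _ => {g | g.β = 0 ∧ g.a = 0 ∧ rot g.R u = u}
  | orb8p _ _ _ =>
      {g | g.φt = 0 ∧ (∃ x : ℝ, g.β = x • u) ∧ (∃ x : ℝ, g.a = x • v) ∧
        ((g.R : ℍ[ℝ]) = 1 ∨ (g.R : ℍ[ℝ]) = -1)}
  | orb8pp d₀ p₀ ε₀ c₀ =>
      {g | g.φt = 0 ∧ g.s = d₀ * (g.a ⬝ᵥ u) / c₀ ∧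
        ((g.R : ℍ[ℝ]) = 1 ∨ (g.R : ℍ[ℝ]) = -1) ∧
        g.a ⨯₃ (p₀ • v + (ε₀ * d₀ / c₀) • u) = g.β ⨯₃ (d₀ • u)}
  | orb8ppp _ _ => {g | g.φt = 0 ∧ g.β = 0 ∧ g.a = 0 ∧ g.s = 0}
  | orb10 _ _ _ => {g | g.φt = 0 ∧ g.β = 0 ∧ g.a = 0 ∧ g.s = 0 ∧ rot g.R u = u}

/-- The defining equations of the orbit, as conditions on the coordinates of the moment
`M(q, qt, d, p, j, E, c)`. -/
def Eqns (q qt : ℝ) (d p j : V3) (E c : ℝ) : Row → Prop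
  | orb0 qt₀ E₀ => c = 0 ∧ E = E₀ ∧ q = 0 ∧ qt = qt₀ ∧ d = 0 ∧ p = 0 ∧ j = 0
  | orb2 ℓ qt₀ E₀ => c = 0 ∧ E = E₀ ∧ q = 0 ∧ qt = qt₀ ∧ d = 0 ∧ p = 0 ∧ len j = ℓ
  | orb2p c₀ => c = c₀ ∧ q = 0 ∧ p = 0 ∧ d = 0 ∧ j = 0
  | orb4 p₀ h qt₀ E₀ =>
      c = 0 ∧ E = E₀ ∧ q = 0 ∧ qt = qt₀ ∧ d = 0 ∧ len p = p₀ ∧ j ⬝ᵥ p = h * p₀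
  | orb4p ℓ c₀ => c = c₀ ∧ q = 0 ∧ p = 0 ∧ d = 0 ∧ len j = ℓ
  | orb6 q₀ qt₀ E₀ =>
      c = 0 ∧ E = E₀ ∧ q = q₀ ∧ qt - len d ^ 2 / (2 * q) = qt₀ ∧ q • j = d ⨯₃ p
  | orb6p d₀ h E₀ =>
      c = 0 ∧ E = E₀ ∧ q = 0 ∧ len d = d₀ ∧ d ⨯₃ p = 0 ∧ j ⬝ᵥ d = h * d₀
  | orb6pp p₀ h c₀ => c = c₀ ∧ q = 0 ∧ d = 0 ∧ len p = p₀ ∧ j ⬝ᵥ p = h * p₀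
  | orb6pppSigned σ E₀ d₀ h c₀ =>
      c = c₀ ∧ q = 0 ∧ p ⨯₃ d = 0 ∧ len d = d₀ ∧ j ⬝ᵥ d = h * d₀ ∧
        E • d + c • p = (σ * E₀) • d
  | orb6pppZero d₀ h c₀ =>
      c = c₀ ∧ q = 0 ∧ p = -(E / c) • d ∧ len d = d₀ ∧ j ⬝ᵥ d = h * d₀
  | orb8 ℓ q₀ qt₀ E₀ =>
      c = 0 ∧ E = E₀ ∧ q = q₀ ∧ qt - len d ^ 2 / (2 * q) = qt₀ ∧
        len (j - (1 / q) • (d ⨯₃ p)) = ℓ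
  | orb8p d₀ p₀ E₀ => c = 0 ∧ E = E₀ ∧ q = 0 ∧ len d = d₀ ∧ len (d ⨯₃ p) = d₀ * p₀
  | orb8pp d₀ p₀ ε₀ c₀ =>
      c = c₀ ∧ q = 0 ∧ len d = d₀ ∧ len (p ⨯₃ d) = p₀ * d₀ ∧
        (E - ε₀) * d₀ ^ 2 = -(c * (p ⬝ᵥ d))
  | orb8ppp r c₀ => c = c₀ ∧ q = r * c ∧ q • j = d ⨯₃ p
  | orb10 ℓ r c₀ => c = c₀ ∧ q = r * c ∧ len (j - (1 / q) • (d ⨯₃ p)) = ℓ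

/-- The zero locus in `𝔤*` of the defining equations. -/
def locus (r : Row) : Set Mom :=
  {α | ∃ q qt d p j E c, α = mom q qt d p j E c ∧ r.Eqns q qt d p j E c}

end Row

end Planon

end

noncomputable section

namespace Planon

/-! ### Euclidean geometry of `ℝ³` -/

/-! The explicit coadjoint action `smul_mom` turns the classification into vector algebra in `ℝ³`.
It fixes `q` and `c`, and it fixes `E` when `c = 0`.

If `q ≠ 0`, the parameters `a` and `β` translate `d` and `p` freely, so both can be made zero. What
survives is the intrinsic spin `j - (d × p) / q`, up to rotation, and for `c = 0` also `qt - ‖d‖² /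
(2q)`. If `q = 0`, the vector `d` only rotates, `φt` shears `p` along `d`, and `j` changes by `a × p
- β × d`. The invariants are then lengths, `‖d × p‖`, and the component of `j` along the common
direction when `d` and `p` are parallel and not both zero. If `c ≠ 0`, `φt` translates `E` and `s`
translates `qt`, so both can be normalised to zero. For `q = 0` the shear of `p` compensates the
shift of `E`, so `E d + c p` merely rotates. Its coefficient along `d ≠ 0` is the extra invariant `E
+ c (p · d) / ‖d‖²`.

That an orbit lies in its locus is the invariance of the equations (`smul_rep_mem_locus`). The
converse `locus_subset_orbit` exhibits a group element, using transitivity of `Spin(3)` on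
orthonormal pairs (`exists_rot_pair`) and the solvability of cross product equations
(`exists_cross_eq`, `exists_dot_cross_eq`). Stabilisers come from solving the fixed point equations
`smul_mom_eq_iff`. Dimensions are constant along orbits because `Ad` preserves the bracket, so a
computation in the standard frame suffices.

Completeness and absence of repetitions both follow from the function `Row.classify`, which reads
the row and its parameters off the coordinates of a moment. For `c = 0` the subgroup `A` acts
trivially (`smul_atEnergy`), which identifies the orbits at energy `E` with Bargmann orbits. -/

theorem V3.ext {v w : V3} (h0 : v 0 = w 0) (h1 : v 1 = w 1) (h2 : v 2 = w 2) : v = w := by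
  ext i; fin_cases i <;> assumption

theorem dot_self_nonneg (v : V3) : 0 ≤ v ⬝ᵥ v := by
  rw [dot_eq]; nlinarith [mul_self_nonneg (v 0), mul_self_nonneg (v 1), mul_self_nonneg (v 2)]

theorem len_sq (v : V3) : len v ^ 2 = v ⬝ᵥ v := Real.sq_sqrt (dot_self_nonneg v)

theorem len_nonneg (v : V3) : 0 ≤ len v := Real.sqrt_nonneg _

theorem len_eq_iff {v : V3} {t : ℝ} (ht : 0 ≤ t) : len v = t ↔ v ⬝ᵥ v = t ^ 2 := by
  rw [← len_sq]
  exact (pow_left_inj₀ (len_nonneg v) ht two_ne_zero).symm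

theorem len_eq_zero {v : V3} : len v = 0 ↔ v = 0 := by
  rw [len_eq_iff le_rfl]; simp

theorem len_pos {v : V3} : 0 < len v ↔ v ≠ 0 := by
  rw [(len_nonneg v).lt_iff_ne, ne_comm, ne_eq, len_eq_zero]

theorem len_smul_unit {u : V3} (hu : u ⬝ᵥ u = 1) {t : ℝ} (ht : 0 ≤ t) : len (t • u) = t := by
  rw [len_eq_iff ht]; simp [hu]; ring

theorem unit_ne_zero {u : V3} (hu : u ⬝ᵥ u = 1) : u ≠ 0 := by
  rintro rfl; simp at hu

theorem smul_cross (t : ℝ) (v w : V3) : (t • v) ⨯₃ w = t • (v ⨯₃ w) := by simp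

theorem cross_smul (t : ℝ) (v w : V3) : v ⨯₃ (t • w) = t • (v ⨯₃ w) := by simp

theorem cross_dot_left (v w : V3) : (v ⨯₃ w) ⬝ᵥ v = 0 := by
  simp only [dot_eq, cross_zero, cross_one, cross_two]; ring

theorem cross_dot_right (v w : V3) : (v ⨯₃ w) ⬝ᵥ w = 0 := by
  simp only [dot_eq, cross_zero, cross_one, cross_two]; ring

theorem cross_cross_eq (v w x : V3) : (v ⨯₃ w) ⨯₃ x = (v ⬝ᵥ x) • w - (w ⬝ᵥ x) • v := by
  apply V3.ext <;> simp [cross_zero, cross_one, cross_two, dot_eq] <;> ring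

theorem cross_dot_self (v w : V3) :
    (v ⨯₃ w) ⬝ᵥ (v ⨯₃ w) = (v ⬝ᵥ v) * (w ⬝ᵥ w) - (v ⬝ᵥ w) ^ 2 := by
  simp only [dot_eq, cross_zero, cross_one, cross_two]; ring

/-- A vector with vanishing cross product with `d ≠ 0` is a multiple of `d`. -/
theorem eq_smul_of_cross_eq_zero {d x : V3} (hd : d ≠ 0) (h : d ⨯₃ x = 0) :
    x = (x ⬝ᵥ d / (d ⬝ᵥ d)) • d := by
  have h1 := cross_cross_eq d x d
  have hd' : d ⬝ᵥ d ≠ 0 := by simpa using hd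
  rw [h, map_zero, LinearMap.zero_apply] at h1
  rw [div_eq_inv_mul, mul_smul, eq_inv_smul_iff₀ hd']
  exact sub_eq_zero.1 h1.symm

/-- The equation `a × d = x` is solvable when `x` is perpendicular to `d ≠ 0`. -/
theorem exists_cross_eq {d x : V3} (hd : d ≠ 0) (h : x ⬝ᵥ d = 0) : ∃ a : V3, a ⨯₃ d = x := by
  have hd' : d ⬝ᵥ d ≠ 0 := by simpa using hd
  -- For `x ⊥ d` the double cross product `(d × x) × d` is `‖d‖² x`.
  refine ⟨(d ⬝ᵥ d)⁻¹ • (d ⨯₃ x), ?_⟩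
  rw [smul_cross, cross_cross_eq, h, zero_smul, sub_zero, inv_smul_smul₀ hd']

/-- Simultaneous solution of `d · a = y` and `a × (x + t d) - β × d = j` for perpendicular
nonzero vectors `d` and `x`. -/
theorem exists_dot_cross_eq {d x : V3} (hd : d ≠ 0) (hx : x ≠ 0) (h : d ⬝ᵥ x = 0) (t y : ℝ)
    (j : V3) : ∃ a β : V3, d ⬝ᵥ a = y ∧ a ⨯₃ (x + t • d) - β ⨯₃ d = j := by
  have hd' : d ⬝ᵥ d ≠ 0 := by simpa using hd
  have hx' : x ⬝ᵥ x ≠ 0 := by simpa using hx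
  -- The term along `d` gives `d · a = y`. The coefficient of `d × x` makes `a × (x + t d) - j`
  -- perpendicular to `d`, which is exactly the solvability condition for `β`.
  set a : V3 := (y / (d ⬝ᵥ d)) • d - (j ⬝ᵥ d / ((x ⬝ᵥ x) * (d ⬝ᵥ d))) • (d ⨯₃ x) with ha
  have h1 : (a ⨯₃ (x + t • d) - j) ⬝ᵥ d = 0 := by
    rw [map_add, cross_smul, sub_dotProduct, add_dotProduct, smul_dotProduct t, cross_dot_right,
      ha, map_sub, LinearMap.sub_apply, smul_cross, smul_cross, cross_cross_eq, h, sub_dotProduct,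
      smul_dotProduct, smul_dotProduct, cross_dot_left, zero_smul, zero_sub, neg_dotProduct,
      smul_dotProduct]
    simp only [smul_eq_mul]
    field_simp
    ring
  obtain ⟨β, hβ⟩ := exists_cross_eq hd h1
  refine ⟨a, β, ?_, by rw [hβ]; abel⟩
  rw [ha, dotProduct_sub, dotProduct_smul, dotProduct_smul, dotProduct_comm d (d ⨯₃ x),
    cross_dot_left]
  simp only [smul_eq_mul, mul_zero, sub_zero]
  field_simp

theorem exists_unit_perp (u : V3) : ∃ v : V3, v ⬝ᵥ v = 1 ∧ u ⬝ᵥ v = 0 := by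
  have key : ∀ x : V3, x ≠ 0 → u ⬝ᵥ x = 0 → ∃ v : V3, v ⬝ᵥ v = 1 ∧ u ⬝ᵥ v = 0 := fun x hx h => by
    have h0 := (len_pos.2 hx).ne'
    refine ⟨(len x)⁻¹ • x, ?_, by simp [h]⟩
    rw [smul_dotProduct, dotProduct_smul, ← len_sq]
    simp only [smul_eq_mul]
    field_simp
  by_cases h : u 0 = 0 ∧ u 1 = 0
  · exact ⟨![1, 0, 0], by simp, by rw [dot_eq, h.1]; simp⟩
  · refine key ![-u 1, u 0, 0] (fun h' => h ⟨?_, ?_⟩) (by rw [dot_eq]; simp; ring)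
    · simpa using congrFun h' 1
    · simpa using congrFun h' 0

/-! ### Transitivity of `Spin(3)` on orthonormal pairs, and the kernel of its action -/

/-- The half turn about the axis `n`. -/
def halfTurn (n : V3) (hn : n ⬝ᵥ n = 1) : Spin3 := ⟨toIm n, by
  rw [dot_eq] at hn
  rw [Unitary.mem_iff]
  constructor <;> ext <;>
    simp [Quaternion.re_mul, Quaternion.imI_mul, Quaternion.imJ_mul, Quaternion.imK_mul] <;>
    linarith⟩

theorem rot_halfTurn (n : V3) (hn : n ⬝ᵥ n = 1) (x : V3) :
    rot (halfTurn n hn) x = (2 * (n ⬝ᵥ x)) • n - x := by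
  have h := hn
  rw [dot_eq] at h
  apply V3.ext <;> simp [rot_def, halfTurn, qrot_zero, qrot_one, qrot_two, dot_eq]
  · linear_combination (-x 0) * h
  · linear_combination (-x 1) * h
  · linear_combination (-x 2) * h

/-- Two unit vectors are exchanged by a half turn, which can be chosen to invert a given unit vector
perpendicular to both. -/
theorem exists_halfTurn {u u' : V3} (hu : u ⬝ᵥ u = 1) (hu' : u' ⬝ᵥ u' = 1) :
    ∃ (n : V3) (hn : n ⬝ᵥ n = 1), rot (halfTurn n hn) u = u' ∧
      ∀ e : V3, e ⬝ᵥ e = 1 → e ⬝ᵥ u = 0 → e ⬝ᵥ u' = 0 →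
        ∃ (m : V3) (hm : m ⬝ᵥ m = 1), rot (halfTurn m hm) u = u' ∧
          rot (halfTurn m hm) e = -e := by
  -- The axis is the bisector of `u` and `u'`, which is perpendicular to `e`. It degenerates when
  -- `u' = -u`. Then any axis perpendicular to `u` exchanges them, and `e × u` is one that also
  -- inverts `e`.
  by_cases h : u + u' = 0
  · obtain rfl : u' = -u := (neg_eq_of_add_eq_zero_right h).symm
    obtain ⟨n, hn, hn'⟩ := exists_unit_perp u
    refine ⟨n, hn, by rw [rot_halfTurn, dotProduct_comm, hn']; simp, fun e he h1 _ => ?_⟩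
    have hm : (e ⨯₃ u) ⬝ᵥ (e ⨯₃ u) = 1 := by rw [cross_dot_self, he, hu, h1]; norm_num
    refine ⟨e ⨯₃ u, hm, ?_, ?_⟩
    · rw [rot_halfTurn, cross_dot_right]; simp
    · rw [rot_halfTurn, cross_dot_left]; simp
  · have h0 := (len_pos.2 h).ne'
    have h2 : len (u + u') ^ 2 = 2 + 2 * (u ⬝ᵥ u') := by
      rw [len_sq]
      simp only [add_dotProduct, dotProduct_add, hu, hu', dotProduct_comm u' u]
      ring
    have hn : ((len (u + u'))⁻¹ • (u + u')) ⬝ᵥ ((len (u + u'))⁻¹ • (u + u')) = 1 := by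
      rw [smul_dotProduct, dotProduct_smul, ← len_sq]
      simp only [smul_eq_mul]
      field_simp
    have h3 : rot (halfTurn _ hn) u = u' := by
      have h4 : 2 * ((len (u + u'))⁻¹ • (u + u')) ⬝ᵥ u * (len (u + u'))⁻¹ = 1 := by
        rw [smul_dotProduct, add_dotProduct, hu, dotProduct_comm u' u, smul_eq_mul]
        field_simp
        linarith
      rw [rot_halfTurn, smul_smul, h4]
      simp
    refine ⟨_, hn, h3, fun e _ h5 h6 => ⟨_, hn, h3, ?_⟩⟩
    rw [rot_halfTurn, smul_dotProduct, add_dotProduct, dotProduct_comm u, h5,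
      dotProduct_comm u', h6]
    simp

/-- `Spin(3)` acts transitively on orthonormal pairs. -/
theorem exists_rot_pair {u v u' v' : V3} (hu : u ⬝ᵥ u = 1) (hv : v ⬝ᵥ v = 1) (huv : u ⬝ᵥ v = 0)
    (hu' : u' ⬝ᵥ u' = 1) (hv' : v' ⬝ᵥ v' = 1) (huv' : u' ⬝ᵥ v' = 0) :
    ∃ R : Spin3, rot R u = u' ∧ rot R v = v' := by
  -- The target is `-u'` because the second half turn, which carries the image of `v` to `v'`,
  -- inverts `u'`.
  obtain ⟨n, hn, h1, -⟩ := exists_halfTurn (u' := -u') hu (by simpa using hu')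
  have h2 : u' ⬝ᵥ rot (halfTurn n hn) v = 0 := by
    have := rot_dot (halfTurn n hn) u v
    rw [h1, huv] at this
    simpa using this
  obtain ⟨-, -, -, h⟩ := exists_halfTurn (u := rot (halfTurn n hn) v) (u' := v')
    (by rw [rot_dot, hv]) hv'
  obtain ⟨m, hm, h3, h4⟩ := h u' hu' h2 huv'
  exact ⟨halfTurn m hm * halfTurn n hn, by rw [rot_mul, h1, map_neg, h4, neg_neg],
    by rw [rot_mul, h3]⟩

theorem inv_smul_dot_self {x : V3} {t : ℝ} (ht : 0 < t) (hx : len x = t) :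
    (t⁻¹ • x) ⬝ᵥ (t⁻¹ • x) = 1 := by
  rw [len_eq_iff ht.le] at hx
  rw [smul_dotProduct, dotProduct_smul, hx]
  simp only [smul_eq_mul]
  field_simp

theorem exists_rot_smul {u : V3} (hu : u ⬝ᵥ u = 1) {x : V3} {t : ℝ} (ht : 0 < t)
    (hx : len x = t) : ∃ R : Spin3, t • rot R u = x := by
  obtain ⟨n, hn, h, -⟩ := exists_halfTurn hu (inv_smul_dot_self ht hx)
  exact ⟨halfTurn n hn, by rw [h, smul_inv_smul₀ ht.ne']⟩

theorem exists_rot_smul_pair {u v : V3} (hu : u ⬝ᵥ u = 1) (hv : v ⬝ᵥ v = 1) (huv : u ⬝ᵥ v = 0)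
    {x y : V3} {s t : ℝ} (hs : 0 < s) (ht : 0 < t) (hx : len x = s) (hy : len y = t)
    (hxy : x ⬝ᵥ y = 0) : ∃ R : Spin3, s • rot R u = x ∧ t • rot R v = y := by
  obtain ⟨R, h1, h2⟩ := exists_rot_pair hu hv huv (inv_smul_dot_self hs hx)
    (inv_smul_dot_self ht hy) (by simp [hxy])
  exact ⟨R, by rw [h1, smul_inv_smul₀ hs.ne'], by rw [h2, smul_inv_smul₀ ht.ne']⟩

/-- A vector is determined by its components along an orthonormal frame. -/
theorem eq_zero_of_dot_frame {u v : V3} (hu : u ⬝ᵥ u = 1) (hv : v ⬝ᵥ v = 1) (huv : u ⬝ᵥ v = 0)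
    {x : V3} (h1 : x ⬝ᵥ u = 0) (h2 : x ⬝ᵥ v = 0) (h3 : x ⬝ᵥ (u ⨯₃ v) = 0) : x = 0 := by
  -- Vanishing components along `u` and `v` give `(u × v) × x = 0`. As `u × v` is a unit vector
  -- perpendicular to `x`, the norm of this product is `‖x‖`.
  have h4 := cross_cross_eq u v x
  rw [dotProduct_comm, h1, dotProduct_comm v, h2, zero_smul, zero_smul, sub_zero] at h4
  have h5 := cross_dot_self (u ⨯₃ v) x
  rw [h4, cross_dot_self, hu, hv, huv, dotProduct_comm (u ⨯₃ v) x, h3] at h5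
  simpa using h5.symm

/-- The kernel of `Spin(3) → SO(3)` is `±1`. -/
theorem rot_eq_id_iff (R : Spin3) :
    (∀ x, rot R x = x) ↔ ((R : ℍ[ℝ]) = 1 ∨ (R : ℍ[ℝ]) = -1) := by
  constructor
  · intro h
    -- Two diagonal entries of the rotation matrix suffice: compared with the unit norm, the first
    -- being `1` kills `imJ` and `imK`, the second kills `imI` and `imK`.
    have h0 := congrFun (h ![1, 0, 0]) 0
    have h1 := congrFun (h ![0, 1, 0]) 1
    have hs := R.sq_sum
    simp [rot_def, qrot_zero, qrot_one] at h0 h1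
    have hk : (R : ℍ[ℝ]).imK = 0 := (pow_eq_zero_iff two_ne_zero).1 (by
      nlinarith [sq_nonneg (R : ℍ[ℝ]).imI, sq_nonneg (R : ℍ[ℝ]).imJ, sq_nonneg (R : ℍ[ℝ]).imK])
    have hj : (R : ℍ[ℝ]).imJ = 0 := (pow_eq_zero_iff two_ne_zero).1 (by
      nlinarith [sq_nonneg (R : ℍ[ℝ]).imI, sq_nonneg (R : ℍ[ℝ]).imJ, sq_nonneg (R : ℍ[ℝ]).imK])
    have hi : (R : ℍ[ℝ]).imI = 0 := (pow_eq_zero_iff two_ne_zero).1 (by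
      nlinarith [sq_nonneg (R : ℍ[ℝ]).imI, sq_nonneg (R : ℍ[ℝ]).imJ, sq_nonneg (R : ℍ[ℝ]).imK])
    rw [hi, hj, hk] at hs
    have hr : (R : ℍ[ℝ]).re ^ 2 = 1 := by linarith
    rcases sq_eq_one_iff.1 hr with h | h
    · left; ext <;> simp [*]
    · right; ext <;> simp [*]
  · rintro (h | h) x <;> apply V3.ext <;> simp [rot_def, h, qrot_zero, qrot_one, qrot_two]

/-- A rotation fixing `u` and `v` fixes `u × v`, hence preserves all components along this frame. -/
theorem rot_fix_frame_iff {u v : V3} (hu : u ⬝ᵥ u = 1) (hv : v ⬝ᵥ v = 1) (huv : u ⬝ᵥ v = 0)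
    (R : Spin3) : (rot R u = u ∧ rot R v = v) ↔ ((R : ℍ[ℝ]) = 1 ∨ (R : ℍ[ℝ]) = -1) := by
  rw [← rot_eq_id_iff]
  refine ⟨fun ⟨h1, h2⟩ x => sub_eq_zero.1 (eq_zero_of_dot_frame hu hv huv ?_ ?_ ?_),
    fun h => ⟨h u, h v⟩⟩ <;> rw [sub_dotProduct, sub_eq_zero]
  · conv_lhs => rw [← h1]
    exact rot_dot R x u
  · conv_lhs => rw [← h2]
    exact rot_dot R x v
  · have h3 : rot R (u ⨯₃ v) = u ⨯₃ v := by rw [rot_cross, h1, h2]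
    conv_lhs => rw [← h3]
    exact rot_dot R x (u ⨯₃ v)

/-! ### Orbits and stabilisers -/

theorem mom_inj {q qt E c q' qt' E' c' : ℝ} {d p j d' p' j' : V3} :
    mom q qt d p j E c = mom q' qt' d' p' j' E' c' ↔
      q = q' ∧ qt = qt' ∧ d = d' ∧ p = p' ∧ j = j' ∧ E = E' ∧ c = c' := by
  constructor
  · intro h
    have key := fun X : Alg => by simpa only [mom_apply] using LinearMap.congr_fun h X
    refine ⟨?_, ?_, ?_, ?_, ?_, ?_, ?_⟩
    · simpa using key ⟨0, 0, 0, 1, 0, 0, 0⟩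
    · simpa using key ⟨0, 0, 0, 0, 1, 0, 0⟩
    · ext i; simpa using key ⟨0, 0, Pi.single i 1, 0, 0, 0, 0⟩
    · ext i; simpa using key ⟨0, Pi.single i 1, 0, 0, 0, 0, 0⟩
    · ext i; simpa using key ⟨Pi.single i 1, 0, 0, 0, 0, 0, 0⟩
    · simpa using key ⟨0, 0, 0, 0, 0, 1, 0⟩
    · simpa using key ⟨0, 0, 0, 0, 0, 0, 1⟩
  · rintro ⟨rfl, rfl, rfl, rfl, rfl, rfl, rfl⟩
    rfl

theorem Row.mom_mem_locus {r : Row} {q qt E c : ℝ} {d p j : V3} :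
    mom q qt d p j E c ∈ r.locus ↔ r.Eqns q qt d p j E c := by
  constructor
  · rintro ⟨_, _, _, _, _, _, _, h, h'⟩
    obtain ⟨rfl, rfl, rfl, rfl, rfl, rfl, rfl⟩ := mom_inj.1 h
    exact h'
  · exact fun h => ⟨_, _, _, _, _, _, _, rfl, h⟩

/-- The fixed point equation for `d` is substituted into those for `p` and `j`, so that `φt` and `β`
act there through `d` itself. -/
theorem smul_mom_eq_iff {g : Grp} {q qt E c : ℝ} {d p j : V3} :
    g • mom q qt d p j E c = mom q qt d p j E c ↔
      rot g.R d + q • g.a = d ∧ rot g.R p + q • g.β - g.φt • d = p ∧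
      rot g.R j - g.β ⨯₃ d + g.a ⨯₃ rot g.R p = j ∧
      rot g.R d ⬝ᵥ g.a + q * (g.a ⬝ᵥ g.a) / 2 = c * g.s ∧ c * g.φt = 0 := by
  rw [smul_mom, mom_inj]
  constructor
  · rintro ⟨-, h1, h2, h3, h4, h5, -⟩
    rw [h2] at h3 h4
    exact ⟨h2, h3, h4, by linarith, by linarith⟩
  · rintro ⟨h2, h3, h4, h1, h5⟩
    rw [h2]
    exact ⟨rfl, by linarith, rfl, h3, h4, by linarith, rfl⟩

/-- Elements with `φ = w = 0` suffice, since `Q` and `W` are central. The conditions for `p'` and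
`j'` are phrased with the target `d'`, which is the vector on which `φt` and `β` act. -/
theorem mom_mem_orbit {q qt E c qt' E' : ℝ} {d p j d' p' j' : V3} (φt s : ℝ) (β a : V3)
    (R : Spin3) (hd : rot R d + q • a = d') (hp : rot R p + q • β - φt • d' = p')
    (hj : rot R j - β ⨯₃ d' + a ⨯₃ rot R p = j')
    (hqt : qt + rot R d ⬝ᵥ a + q * (a ⬝ᵥ a) / 2 - c * s = qt') (hE : E + c * φt = E') :
    mom q qt' d' p' j' E' c ∈ MulAction.orbit Grp (mom q qt d p j E c) := by
  refine ⟨⟨0, φt, β, a, R, s, 0⟩, ?_⟩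
  change (⟨0, φt, β, a, R, s, 0⟩ : Grp) • mom q qt d p j E c = _
  rw [smul_mom, mom_inj]
  subst hd hp hj hqt hE
  exact ⟨rfl, rfl, rfl, rfl, rfl, rfl, rfl⟩

/-! ### The orbits as loci of their equations -/

variable {u v : V3}

/-- The coordinates of `g • r.rep u v` involve `u` and `v` only through `rot R u` and `rot R v`,
which are again orthonormal. The translation terms cancel in each defining equation. -/
theorem smul_rep_mem_locus (hu : u ⬝ᵥ u = 1) (hv : v ⬝ᵥ v = 1) (huv : u ⬝ᵥ v = 0) {r : Row}
    (hr : r.Admissible) (g : Grp) : g • r.rep u v ∈ r.locus := by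
  obtain ⟨R, hR⟩ : ∃ R, R = g.R := ⟨_, rfl⟩
  have hu' : rot R u ⬝ᵥ rot R u = 1 := by rw [rot_dot, hu]
  have hv' : rot R v ⬝ᵥ rot R v = 1 := by rw [rot_dot, hv]
  have huv' : rot R u ⬝ᵥ rot R v = 0 := by rw [rot_dot, huv]
  have hvu' : rot R v ⬝ᵥ rot R u = 0 := by rw [dotProduct_comm, huv']
  have lu {t : ℝ} (ht : 0 < t) : len (t • rot R u) = t := len_smul_unit hu' ht.le
  have hβ : g.β ⨯₃ g.a = -(g.a ⨯₃ g.β) := (cross_anticomm g.a g.β).symm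
  cases r <;> simp only [Row.rep, Row.Admissible] at hr ⊢ <;>
    rw [smul_mom, Row.mom_mem_locus] <;> simp only [Row.Eqns, ← hR, map_zero (rot R),
      map_smul (rot R), map_add (rot R), zero_smul, add_zero, zero_add]
  case orb0 => simp
  case orb2 => simpa using lu hr
  case orb2p => simp
  case orb4 =>
    refine ⟨trivial, by simp, trivial, by simp, by simp, by simpa using lu hr, ?_⟩
    simp [hu', cross_dot_right, mul_comm]
  case orb4p => simpa using lu hr.1
  case orb6 q₀ qt₀ E₀ =>
    refine ⟨trivial, by simp, trivial, ?_, ?_⟩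
    · rw [len_sq]; simp; field_simp; ring
    · simp [hβ, -cross_anticomm]
  case orb6p =>
    refine ⟨trivial, by simp, trivial, by simpa using lu hr, by simp, ?_⟩
    simp [hu', cross_dot_right, mul_comm]
  case orb6pp =>
    refine ⟨trivial, trivial, by simp, by simpa using lu hr.1, ?_⟩
    simp [hu', cross_dot_right, mul_comm]
  case orb6pppSigned =>
    obtain ⟨-, -, hd, hc⟩ := hr
    refine ⟨trivial, trivial, by simp, by simpa using lu hd, by simp [hu', cross_dot_right, mul_comm],
      ?_⟩
    match_scalars
    field_simp
    ring
  case orb6pppZero =>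
    obtain ⟨hd, hc⟩ := hr
    refine ⟨trivial, trivial, ?_, by simpa using lu hd, by simp [hu', cross_dot_right, mul_comm]⟩
    rw [zero_sub]
    match_scalars
    field_simp
  case orb8 ℓ q₀ qt₀ E₀ =>
    obtain ⟨hl, hq⟩ := hr
    refine ⟨trivial, by simp, trivial, ?_, ?_⟩
    · rw [len_sq]; simp; field_simp; ring
    · refine Eq.trans (congrArg len ?_) (lu hl)
      simp [hβ, -cross_anticomm, smul_smul, hq]
  case orb8p d₀ p₀ E₀ =>
    obtain ⟨hd, hp⟩ := hr
    refine ⟨trivial, by simp, trivial, by simpa using lu hd, ?_⟩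
    rw [len_eq_iff (by positivity), cross_dot_self]
    simp [hu', hv', huv', hvu']
    ring
  case orb8pp d₀ p₀ ε₀ c₀ =>
    obtain ⟨hd, hp, hc⟩ := hr
    refine ⟨trivial, trivial, by simpa using lu hd, ?_, ?_⟩
    · rw [len_eq_iff (by positivity), cross_dot_self]
      simp [hu', hv', huv', hvu']
      ring
    · simp [hu', hvu']
      field_simp
      ring
  case orb8ppp r c₀ =>
    obtain ⟨hr, hc⟩ := hr
    exact ⟨trivial, trivial, by simp [hβ, -cross_anticomm]⟩
  case orb10 ℓ r c₀ =>
    obtain ⟨hl, hr, hc⟩ := hr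
    refine ⟨trivial, trivial, ?_⟩
    refine Eq.trans (congrArg len ?_) (lu hl)
    simp only [map_zero, sub_zero, add_zero, map_sub, map_smul,
      LinearMap.smul_apply, cross_self, smul_zero, hβ]
    match_scalars
    · simp
    · field_simp
      simp

/-- The component of `j` along `d` is invariant; the rest is perpendicular to `d`, so
`exists_cross_eq` can produce it by a translation. It is also applied with `p` in the role of `d`.
-/
theorem perp_of_dot_eq {d : V3} {R : Spin3} {u j : V3} {d₀ h : ℝ} (hu : u ⬝ᵥ u = 1)
    (hd : d₀ • rot R u = d) (hj : j ⬝ᵥ d = h * d₀) : (j - h • rot R u) ⬝ᵥ d = 0 := by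
  rw [sub_dotProduct, hj, ← hd]
  simp [rot_dot, hu, mul_comm]

theorem locus_subset_orbit (hu : u ⬝ᵥ u = 1) (hv : v ⬝ᵥ v = 1) (huv : u ⬝ᵥ v = 0) {r : Row}
    (hr : r.Admissible) : r.locus ⊆ MulAction.orbit Grp (r.rep u v) := by
  rintro _ ⟨q, qt, d, p, j, E, c, rfl, h⟩
  have hpd : p ⨯₃ d = -(d ⨯₃ p) := (cross_anticomm d p).symm
  cases r <;> simp only [Row.rep, Row.Admissible, Row.Eqns] at hr h ⊢
  case orb0 =>
    obtain ⟨rfl, rfl, rfl, rfl, rfl, rfl, rfl⟩ := h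
    exact MulAction.mem_orbit_self _
  case orb2 =>
    obtain ⟨rfl, rfl, rfl, rfl, rfl, rfl, hj⟩ := h
    obtain ⟨R, rfl⟩ := exists_rot_smul hu hr hj
    exact mom_mem_orbit 0 0 0 0 R (by simp) (by simp) (by simp) (by simp) (by simp)
  case orb2p c₀ =>
    obtain ⟨rfl, rfl, rfl, rfl, rfl⟩ := h
    -- Starting from `E = qt = 0`, the action gives `E = c φt` and `qt = -c s`; this fixes `φt` and
    -- `s` here and in later rows with `c ≠ 0` and no contribution of `a` to `qt`.
    exact mom_mem_orbit (E / c) (-qt / c) 0 0 1 (by simp) (by simp) (by simp)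
      (by simp; field_simp) (by field_simp; simp)
  case orb4 p₀ h₀ _ _ =>
    obtain ⟨rfl, rfl, rfl, rfl, rfl, hp, hj⟩ := h
    obtain ⟨R, hR⟩ := exists_rot_smul hu hr hp
    obtain ⟨a, ha⟩ := exists_cross_eq (len_pos.1 (hp ▸ hr)) (perp_of_dot_eq hu hR hj)
    exact mom_mem_orbit 0 0 0 a R (by simp) (by simpa using hR)
      (by rw [map_smul, map_smul, hR, ha]; simp) (by simp) (by simp)
  case orb4p =>
    obtain ⟨rfl, rfl, rfl, rfl, hj⟩ := h
    obtain ⟨hl, hc⟩ := hr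
    obtain ⟨R, rfl⟩ := exists_rot_smul hu hl hj
    exact mom_mem_orbit (E / c) (-qt / c) 0 0 R (by simp) (by simp) (by simp)
      (by simp; field_simp) (by field_simp; simp)
  case orb6 =>
    obtain ⟨rfl, rfl, rfl, hqt, hj⟩ := h
    refine mom_mem_orbit 0 0 (q⁻¹ • p) (q⁻¹ • d) 1 (by simp [hr]) (by simp [hr]) ?_ ?_ (by simp)
    · rw [(eq_inv_smul_iff₀ hr).2 hj, smul_cross, hpd]
      simp [-cross_anticomm]
    · rw [← hqt, len_sq]
      simp
      field_simp
      ring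
  case orb6p d₀ h₀ E₀ =>
    obtain ⟨rfl, rfl, rfl, hd, hp, hj⟩ := h
    have hd0 := len_pos.1 (hd ▸ hr)
    have hdd : d ⬝ᵥ d ≠ 0 := by simpa using hd0
    obtain ⟨R, hR⟩ := exists_rot_smul hu hr hd
    obtain ⟨β, hβ⟩ := exists_cross_eq hd0 (perp_of_dot_eq hu hR hj)
    -- The shear by `φt` creates `p`, which is parallel to `d`; `a` along `d` creates `qt`; and `β`
    -- supplies the part of `j` perpendicular to `d`.
    refine mom_mem_orbit (-(p ⬝ᵥ d / (d ⬝ᵥ d))) 0 (-β) ((qt / (d ⬝ᵥ d)) • d) R (by simpa using hR)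
      ?_ (by simp [hβ]) ?_ (by simp)
    · conv_rhs => rw [eq_smul_of_cross_eq_zero hd0 hp]
      simp
    · rw [map_smul, hR]
      simp
      field_simp
  case orb6pp =>
    obtain ⟨rfl, rfl, rfl, hp, hj⟩ := h
    obtain ⟨hp0, hc⟩ := hr
    obtain ⟨R, hR⟩ := exists_rot_smul hu hp0 hp
    obtain ⟨a, ha⟩ := exists_cross_eq (len_pos.1 (hp ▸ hp0)) (perp_of_dot_eq hu hR hj)
    exact mom_mem_orbit (E / c) (-qt / c) 0 a R (by simp) (by simpa using hR)
      (by rw [map_smul, map_smul, hR, ha]; simp) (by simp; field_simp) (by field_simp; simp)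
  case orb6pppSigned σ E₀ d₀ h₀ c₀ =>
    obtain ⟨rfl, rfl, -, hd, hj, hp⟩ := h
    obtain ⟨-, -, hd0, hc⟩ := hr
    obtain ⟨R, hR⟩ := exists_rot_smul hu hd0 hd
    obtain ⟨β, hβ⟩ := exists_cross_eq (len_pos.1 (hd ▸ hd0)) (perp_of_dot_eq hu hR hj)
    refine mom_mem_orbit (E / c) (-qt / c) (-β) 0 R (by simpa using hR) ?_ (by simp [hβ])
      (by simp; field_simp) (by field_simp; simp)
    have hp' : p = c⁻¹ • ((σ * E₀) • d - E • d) := by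
      rw [eq_inv_smul_iff₀ hc, ← hp]; abel
    rw [hp', ← hR, map_smul]
    module
  case orb6pppZero d₀ h₀ c₀ =>
    obtain ⟨rfl, rfl, hp, hd, hj⟩ := h
    obtain ⟨hd0, hc⟩ := hr
    obtain ⟨R, hR⟩ := exists_rot_smul hu hd0 hd
    obtain ⟨β, hβ⟩ := exists_cross_eq (len_pos.1 (hd ▸ hd0)) (perp_of_dot_eq hu hR hj)
    exact mom_mem_orbit (E / c) (-qt / c) (-β) 0 R (by simpa using hR) (by rw [hp]; simp)
      (by simp [hβ]) (by simp; field_simp) (by field_simp; simp)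
  case orb8 ℓ q₀ _ _ =>
    obtain ⟨rfl, rfl, rfl, hqt, hj⟩ := h
    obtain ⟨hl, hq⟩ := hr
    obtain ⟨R, hR⟩ := exists_rot_smul hu hl hj
    refine mom_mem_orbit 0 0 (q⁻¹ • p) (q⁻¹ • d) R (by simp [hq]) (by simp [hq]) ?_ ?_ (by simp)
    · rw [map_smul, hR, smul_cross, hpd]
      simp [-cross_anticomm]
    · rw [← hqt, len_sq]
      simp
      field_simp
      ring
  case orb8p d₀ p₀ _ =>
    obtain ⟨rfl, rfl, rfl, hd, hp⟩ := h
    obtain ⟨hd0, hp0⟩ := hr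
    have hdd := (len_eq_iff hd0.le).1 hd
    have hpp := (len_eq_iff (by positivity)).1 hp
    -- The component `t d` of `p` comes from the shear; the remainder is perpendicular to `d` and
    -- has length `p₀`.
    obtain ⟨t, ht⟩ : ∃ t, t = p ⬝ᵥ d / (d ⬝ᵥ d) := ⟨_, rfl⟩
    have hperp : d ⬝ᵥ (p - t • d) = 0 := by
      rw [ht, dotProduct_sub, dotProduct_smul, dotProduct_comm d p, smul_eq_mul, hdd]
      field_simp
      ring
    have hlen : len (p - t • d) = p₀ := by
      have h1 := cross_dot_self d (p - t • d)
      rw [hperp, map_sub, map_smul, cross_self, smul_zero, sub_zero, hpp, hdd] at h1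
      rw [len_eq_iff hp0.le]
      have : d₀ ^ 2 ≠ 0 := by positivity
      apply mul_left_cancel₀ this
      linarith
    obtain ⟨R, hR, hR'⟩ := exists_rot_smul_pair hu hv huv hd0 hp0 hd hlen hperp
    -- As `a` enters both `qt` and `j`, the two conditions must be solved together.
    obtain ⟨a, β, ha, hβ⟩ := exists_dot_cross_eq (len_pos.1 (hd ▸ hd0))
      (len_pos.1 (hlen ▸ hp0)) hperp 0 qt j
    refine mom_mem_orbit (-t) 0 β a R (by simpa using hR) ?_ ?_ ?_ (by simp)
    · rw [map_smul, hR']; simp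
    · rw [map_smul, hR', ← hβ, zero_smul, add_zero, map_zero (rot R)]; abel
    · rw [map_smul, hR, ha]; simp
  case orb8pp d₀ p₀ ε₀ c₀ =>
    obtain ⟨rfl, rfl, hd, hp, hE⟩ := h
    obtain ⟨hd0, hp0, hc⟩ := hr
    have hdd := (len_eq_iff hd0.le).1 hd
    have hpp := (len_eq_iff (by positivity)).1 hp
    -- By the last equation of the locus, `-t d` is the component of `p` along `d`. The
    -- representative has `(ε₀ / c) d` there after rotation, and the shear by `φt = E / c` accounts
    -- for the difference.
    obtain ⟨t, ht⟩ : ∃ t, t = E / c - ε₀ / c := ⟨_, rfl⟩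
    have hperp : d ⬝ᵥ (p + t • d) = 0 := by
      rw [ht, dotProduct_add, dotProduct_smul, dotProduct_comm d p, smul_eq_mul, hdd]
      field_simp
      linarith
    have hlen : len (p + t • d) = p₀ := by
      have h1 := cross_dot_self d (p + t • d)
      rw [hperp, map_add, map_smul, cross_self, smul_zero, add_zero, hdd, ← cross_anticomm,
        neg_dotProduct_neg, hpp] at h1
      rw [len_eq_iff hp0.le]
      have : d₀ ^ 2 ≠ 0 := by positivity
      apply mul_left_cancel₀ this
      linarith
    obtain ⟨R, hR, hR'⟩ := exists_rot_smul_pair hu hv huv hd0 hp0 hd hlen hperp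
    obtain ⟨a, β, ha, hβ⟩ := exists_dot_cross_eq (len_pos.1 (hd ▸ hd0))
      (len_pos.1 (hlen ▸ hp0)) hperp (ε₀ / c) qt j
    have hp' : rot R (p₀ • v + (ε₀ * d₀ / c) • u) = p + t • d + (ε₀ / c) • d := by
      rw [map_add, map_smul, map_smul, hR', ← hR]
      module
    refine mom_mem_orbit (E / c) 0 β a R (by simpa using hR) ?_ ?_ ?_
      (by field_simp; simp)
    · rw [hp', ht]; module
    · rw [hp', ← hβ, map_zero (rot R)]; abel
    · rw [map_smul, hR, ha]; simp
  case orb8ppp r c₀ =>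
    obtain ⟨rfl, rfl, hj⟩ := h
    obtain ⟨hr, hc⟩ := hr
    have hq : r * c ≠ 0 := mul_ne_zero hr hc
    generalize r * c = q at *
    -- The term `(E / c) d` in `q β` cancels the shear needed to reach `E`, and `s` is solved from
    -- `q ‖a‖² / 2 - c s = qt` with `a = d / q`.
    refine mom_mem_orbit (E / c) ((q * (q⁻¹ * q⁻¹ * (d ⬝ᵥ d)) / 2 - qt) / c)
      (q⁻¹ • (p + (E / c) • d)) (q⁻¹ • d) 1 (by simp [hq]) (by simp [hq]) ?_ ?_
      (by field_simp; simp)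
    · rw [(eq_inv_smul_iff₀ hq).2 hj, smul_cross, LinearMap.map_add₂, smul_cross, cross_self, hpd]
      simp [-cross_anticomm]
    · simp
      field_simp
      ring
  case orb10 ℓ r c₀ =>
    obtain ⟨rfl, rfl, hj⟩ := h
    obtain ⟨hl, hr, hc⟩ := hr
    have hq : r * c ≠ 0 := mul_ne_zero hr hc
    generalize r * c = q at *
    obtain ⟨R, hR⟩ := exists_rot_smul hu hl hj
    refine mom_mem_orbit (E / c) ((q * (q⁻¹ * q⁻¹ * (d ⬝ᵥ d)) / 2 - qt) / c)
      (q⁻¹ • (p + (E / c) • d)) (q⁻¹ • d) R (by simp [hq]) (by simp [hq]) ?_ ?_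
      (by field_simp; simp)
    · rw [map_smul, hR, smul_cross, LinearMap.map_add₂, smul_cross, cross_self, hpd]
      simp [-cross_anticomm]
    · simp
      field_simp
      ring

theorem orbit_rep (hu : u ⬝ᵥ u = 1) (hv : v ⬝ᵥ v = 1) (huv : u ⬝ᵥ v = 0) {r : Row}
    (hr : r.Admissible) : MulAction.orbit Grp (r.rep u v) = r.locus :=
  subset_antisymm (Set.range_subset_iff.2 fun g => smul_rep_mem_locus hu hv huv hr g)
    (locus_subset_orbit hu hv huv hr)

/-! ### Stabilisers of the representatives -/

theorem cross_eq_zero_iff_exists_smul (hu : u ⬝ᵥ u = 1) {x : V3} :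
    x ⨯₃ u = 0 ↔ ∃ t : ℝ, x = t • u := by
  constructor
  · intro h
    refine ⟨_, eq_smul_of_cross_eq_zero (unit_ne_zero hu) ?_⟩
    rw [← cross_anticomm, h, neg_zero]
  · rintro ⟨t, rfl⟩
    simp

theorem rot_smul_eq_iff {R : Spin3} {t : ℝ} (ht : t ≠ 0) :
    rot R (t • u) = t • u ↔ rot R u = u := by
  rw [map_smul, smul_right_inj ht]

/-- Since `R` fixes `u`, the vector `R v` stays perpendicular to `u`. The `u`-component of the
equation is then `t d₀ = 0`, and what is left says `R v = v`. The rows `8'` (with `κ = 0`) and `8''`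
share this argument. -/
theorem eq_zero_and_rot_eq_of_shear {R : Spin3} {d₀ p₀ κ t : ℝ} (hu : u ⬝ᵥ u = 1)
    (huv : u ⬝ᵥ v = 0) (hd : d₀ ≠ 0) (hp : p₀ ≠ 0) (h1 : rot R u = u)
    (h2 : p₀ • rot R v + κ • u - t • (d₀ • u) = p₀ • v + κ • u) : t = 0 ∧ rot R v = v := by
  have ht : t = 0 := by
    have h3 := congrArg (u ⬝ᵥ ·) h2
    have h4 := rot_dot R u v
    rw [h1, huv] at h4
    simpa [hu, huv, h4, hd] using h3
  rw [ht, zero_smul, sub_zero, add_left_inj, smul_right_inj hp] at h2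
  exact ⟨ht, h2⟩

theorem stabilizer_rep (hu : u ⬝ᵥ u = 1) (hv : v ⬝ᵥ v = 1) (huv : u ⬝ᵥ v = 0) {r : Row}
    (hr : r.Admissible) :
    (MulAction.stabilizer Grp (r.rep u v) : Set Grp) = r.stab u v := by
  ext g
  rw [SetLike.mem_coe, MulAction.mem_stabilizer_iff]
  cases r <;> simp only [Row.rep, Row.Admissible, Row.stab] at hr ⊢ <;> rw [smul_mom_eq_iff] <;>
    simp only [Set.mem_univ, Set.mem_ofPred_eq, map_zero (rot g.R), zero_smul, smul_zero,
      add_zero, zero_add, zero_mul, zero_div, sub_zero, zero_dotProduct, map_zero, true_and,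
      and_true, zero_sub, neg_eq_zero]
  case orb2 => exact rot_smul_eq_iff hr.ne'
  case orb2p => simp [hr, eq_comm, and_comm]
  case orb4 p₀ h qt₀ E₀ =>
    rw [rot_smul_eq_iff hr.ne']
    refine and_congr_right fun hR => ?_
    rw [map_smul (rot g.R), map_smul (rot g.R), hR, cross_smul, add_eq_left,
      smul_eq_zero_iff_right hr.ne',
      cross_eq_zero_iff_exists_smul hu]
  case orb4p =>
    obtain ⟨hl, hc⟩ := hr
    rw [rot_smul_eq_iff hl.ne']
    simp [hc, eq_comm]
    tauto
  case orb6 =>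
    simp only [smul_eq_zero_iff_right hr]
    constructor
    · rintro ⟨h1, h2, -⟩; exact ⟨h2, h1⟩
    · rintro ⟨h1, h2⟩; simp [h1, h2]
  case orb6p d₀ h E₀ =>
    rw [rot_smul_eq_iff hr.ne', smul_smul, smul_eq_zero]
    have h1 : g.φt * d₀ = 0 ↔ g.φt = 0 := by simp [hr.ne']
    rw [or_iff_left (unit_ne_zero hu), h1, ← cross_eq_zero_iff_exists_smul hu]
    constructor
    · rintro ⟨h2, h3, h4, h5⟩
      rw [map_smul (rot g.R), h2] at h4 h5
      refine ⟨h3, h2, ?_, ?_⟩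
      · simpa [hr.ne'] using h4
      · simpa [hr.ne', dotProduct_comm] using h5
    · rintro ⟨h2, h3, h4, h5⟩
      refine ⟨h3, h2, ?_, ?_⟩
      · simp [h3, h4]
      · simp [h3, dotProduct_comm u, h5]
  case orb6pp p₀ h c₀ =>
    obtain ⟨hp, hc⟩ := hr
    rw [rot_smul_eq_iff hp.ne', ← cross_eq_zero_iff_exists_smul hu, eq_comm (a := (0 : ℝ)),
      mul_eq_zero_iff_left hc, mul_eq_zero_iff_left hc]
    constructor
    · rintro ⟨h2, h3, h4, h5⟩
      rw [map_smul (rot g.R), map_smul (rot g.R), h2] at h3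
      exact ⟨h5, h4, h2, by simpa [hp.ne'] using h3⟩
    · rintro ⟨h2, h3, h4, h5⟩
      exact ⟨h4, by simp [h4, h5], h3, h2⟩
  case orb6pppSigned σ E₀ d₀ h c₀ =>
    obtain ⟨-, -, hd, hc⟩ := hr
    rw [rot_smul_eq_iff hd.ne', mul_eq_zero_iff_left hc]
    constructor
    · rintro ⟨h1, -, h3, h4, h5⟩
      rw [map_smul (rot g.R), h1, smul_dotProduct, dotProduct_comm u] at h4
      rw [map_smul (rot g.R), map_smul (rot g.R), h1] at h3
      refine ⟨h5, ?_, h1, ?_⟩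
      · rw [eq_div_iff hc, mul_comm, ← h4, smul_eq_mul]
      · rw [map_sub, LinearMap.sub_apply, smul_cross, smul_cross, ← neg_eq_zero, neg_sub,
          ← sub_eq_zero.2 h3, cross_smul, cross_smul]
        abel
    · rintro ⟨h5, h4, h1, h3⟩
      refine ⟨h1, by simp [h1, h5], ?_, ?_, h5⟩
      · rw [map_sub, LinearMap.sub_apply, smul_cross, smul_cross, sub_eq_zero] at h3
        rw [map_smul (rot g.R), map_smul (rot g.R), h1, cross_smul, cross_smul, h3]
        abel
      · rw [h4, map_smul (rot g.R), h1, smul_dotProduct, dotProduct_comm u]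
        simp only [smul_eq_mul]
        field_simp
  case orb6pppZero d₀ h c₀ =>
    obtain ⟨hd, hc⟩ := hr
    rw [rot_smul_eq_iff hd.ne', mul_eq_zero_iff_left hc]
    constructor
    · rintro ⟨h1, -, h3, h4, h5⟩
      rw [map_smul (rot g.R), h1, smul_dotProduct, dotProduct_comm u] at h4
      rw [map_smul (rot g.R), h1] at h3
      refine ⟨h5, ?_, h1, ?_⟩
      · rw [eq_div_iff hc, mul_comm, ← h4, smul_eq_mul]
      · simpa using h3
    · rintro ⟨h5, h4, h1, h3⟩
      refine ⟨h1, by simp [h5], ?_, ?_, h5⟩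
      · rw [smul_cross] at h3
        rw [map_smul (rot g.R), h1, cross_smul, h3]
        simp
      · rw [h4, map_smul (rot g.R), h1, smul_dotProduct, dotProduct_comm u]
        simp only [smul_eq_mul]
        field_simp
  case orb8 ℓ q₀ qt₀ E₀ =>
    obtain ⟨hl, hq⟩ := hr
    simp only [smul_eq_zero_iff_right hq, rot_smul_eq_iff hl.ne']
    constructor
    · rintro ⟨h1, h2, h3, -⟩; exact ⟨h2, h1, h3⟩
    · rintro ⟨h1, h2, h3⟩; simp [h1, h2, h3]
  case orb8p d₀ p₀ E₀ =>
    obtain ⟨hd, hp⟩ := hr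
    rw [rot_smul_eq_iff hd.ne', ← rot_fix_frame_iff hu hv huv,
      ← cross_eq_zero_iff_exists_smul hu, ← cross_eq_zero_iff_exists_smul hv]
    constructor
    · rintro ⟨h1, h2, h3, h4⟩
      obtain ⟨h5, h6⟩ := eq_zero_and_rot_eq_of_shear (κ := 0) hu huv hd.ne' hp.ne' h1
        (by simpa using h2)
      rw [map_smul (rot g.R), h6, cross_smul, cross_smul, neg_add_eq_zero] at h3
      have h7 : g.a ⬝ᵥ u = 0 := by
        simpa [h1, hd.ne', dotProduct_comm] using h4
      -- The component along `u` vanishes because `h3` makes `a × v` proportional to `β × u`; the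
      -- component along `u × v` is `a · u = 0`.
      have h8 : g.a ⨯₃ v = 0 := by
        apply eq_zero_of_dot_frame hu hv huv _ (cross_dot_right _ _)
        · rw [cross_dot_cross, h7, dotProduct_comm v u, huv]
          simp
        · have h9 := congrArg (· ⬝ᵥ u) h3
          simpa [cross_dot_right, hp.ne'] using h9.symm
      refine ⟨h5, ?_, h8, h1, h6⟩
      simpa [h8, hd.ne'] using h3
    · rintro ⟨h5, h2, h3, h1, h6⟩
      refine ⟨h1, by simp [h5, h6], by simp [h2, h3, h6], ?_⟩
      obtain ⟨x, hx⟩ := (cross_eq_zero_iff_exists_smul hv).1 h3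
      simp [h1, hx, huv]
  case orb8pp d₀ p₀ ε₀ c₀ =>
    obtain ⟨hd, hp, hc⟩ := hr
    rw [rot_smul_eq_iff hd.ne', ← rot_fix_frame_iff hu hv huv, mul_eq_zero_iff_left hc]
    constructor
    · rintro ⟨h1, h2, h3, h4, h5⟩
      have h6 : rot g.R v = v := (eq_zero_and_rot_eq_of_shear (κ := ε₀ * d₀ / c₀) hu huv hd.ne'
        hp.ne' h1 (by rw [← h2, map_add, map_smul (rot g.R), map_smul (rot g.R), h1])).2
      rw [map_smul (rot g.R), h1, smul_dotProduct, dotProduct_comm u] at h4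
      rw [map_add, map_smul (rot g.R), map_smul (rot g.R), h1, h6, neg_add_eq_zero] at h3
      refine ⟨h5, ?_, ⟨h1, h6⟩, h3.symm⟩
      rw [eq_div_iff hc, mul_comm, ← h4, smul_eq_mul]
    · rintro ⟨h5, h4, ⟨h1, h6⟩, h3⟩
      have h7 : rot g.R (p₀ • v + (ε₀ * d₀ / c₀) • u) = p₀ • v + (ε₀ * d₀ / c₀) • u := by
        rw [map_add, map_smul (rot g.R), map_smul (rot g.R), h1, h6]
      refine ⟨h1, by rw [h7, h5]; simp, ?_, ?_, h5⟩
      · rw [h7, h3]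
        abel
      · rw [h4, map_smul (rot g.R), h1, smul_dotProduct, dotProduct_comm u]
        simp only [smul_eq_mul]
        field_simp
  case orb8ppp r c₀ =>
    obtain ⟨hr, hc⟩ := hr
    simp only [smul_eq_zero_iff_right (mul_ne_zero hr hc), mul_eq_zero_iff_left hc]
    constructor
    · rintro ⟨h1, h2, h3, h4⟩
      have h5 : g.s = 0 := by simpa [h1, hc, eq_comm] using h3
      exact ⟨h4, h2, h1, h5⟩
    · rintro ⟨h1, h2, h3, h4⟩; simp [h1, h2, h3, h4]
  case orb10 ℓ r c₀ =>
    obtain ⟨hl, hr, hc⟩ := hr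
    simp only [smul_eq_zero_iff_right (mul_ne_zero hr hc), mul_eq_zero_iff_left hc,
      rot_smul_eq_iff hl.ne']
    constructor
    · rintro ⟨h1, h2, h3, h4, h5⟩
      have h6 : g.s = 0 := by simpa [h1, hc, eq_comm] using h4
      exact ⟨h5, h2, h1, h6, h3⟩
    · rintro ⟨h1, h2, h3, h4, h5⟩; simp [h1, h2, h3, h4, h5]

/-! ### Dimensions of the orbits -/

theorem adj_lie (g : Grp) (X Y : Alg) : adj g ⁅X, Y⁆ = ⁅adj g X, adj g Y⁆ := by
  have e1 := rot_dot g.R X.P Y.D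
  have e2 := rot_dot g.R Y.P X.D
  simp only [adj_eq]
  ext1
  · simp [rot_cross]
  · simp only [Alg.lie_P, Alg.lie_L, map_sub, rot_cross]
    apply V3.ext <;> simp [cross_zero, cross_one, cross_two] <;> ring
  · simp only [Alg.lie_P, Alg.lie_L, Alg.lie_D, Alg.lie_Z, map_sub, map_add, map_smul, rot_cross]
    apply V3.ext <;> simp [cross_zero, cross_one, cross_two] <;> ring
  · simp only [Alg.lie_P, Alg.lie_L, Alg.lie_D, Alg.lie_Z, Alg.lie_Q, map_sub (rot g.R),
      map_add (rot g.R), map_smul (rot g.R), rot_cross, ← e1, ← e2]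
    simp [cross_zero, cross_one, cross_two, dot_eq]
    ring
  · simp
  · simp
  · simp

/-- Because `Ad` respects the bracket, the tangent maps at `α` and at `g • α` are conjugate. -/
theorem adStar_smul (g : Grp) (α : Mom) :
    adStar (g • α) = (Ad g⁻¹).dualMap ∘ₗ adStar α ∘ₗ Ad g⁻¹ := by
  ext X Y
  change -(α (adj g⁻¹ ⁅X, Y⁆)) = -(α ⁅adj g⁻¹ X, adj g⁻¹ Y⁆)
  rw [adj_lie]

/-- Composition on either side cannot raise the rank. Applying this to `g⁻¹` gives the reverse
inequality. -/
theorem orbitDim_smul_le (g : Grp) (α : Mom) : orbitDim (g • α) ≤ orbitDim α := by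
  rw [orbitDim, adStar_smul, orbitDim, LinearMap.range_comp]
  exact (Submodule.finrank_map_le _ _).trans
    (Submodule.finrank_mono (LinearMap.range_comp_le_range _ _))

/-- The dimension of the tangent space is constant along an orbit. -/
theorem orbitDim_smul (g : Grp) (α : Mom) : orbitDim (g • α) = orbitDim α :=
  (orbitDim_smul_le g α).antisymm (by simpa using orbitDim_smul_le g⁻¹ (g • α))

/-- The tangent vectors of an orbit in coordinates. -/
theorem adStar_mom (q qt : ℝ) (d p j : V3) (E c : ℝ) (X : Alg) :
    adStar (mom q qt d p j E c) X = mom 0 (d ⬝ᵥ X.P - c * X.H) (X.L ⨯₃ d + q • X.P)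
      (X.L ⨯₃ p + q • X.D - X.Z • d) (X.L ⨯₃ j - X.D ⨯₃ d + X.P ⨯₃ p) (c * X.Z) 0 := by
  ext Y
  change -(mom q qt d p j E c ⁅X, Y⁆) = _
  simp [mom_apply, dot_eq, cross_zero, cross_one, cross_two]
  ring

/-- Evaluation at the `Y i` is a linear isomorphism from the range onto `ℝᵏ`: `h1` gives injectivity
and `h2` surjectivity. -/
theorem finrank_range_eq_of_eval {k : ℕ} (f : Alg →ₗ[ℝ] Mom) (Y : Fin k → Alg)
    (h1 : ∀ X, (∀ i, f X (Y i) = 0) → f X = 0) (h2 : ∀ y : Fin k → ℝ, ∃ X, ∀ i, f X (Y i) = y i) :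
    Module.finrank ℝ (LinearMap.range f) = k := by
  let φ : Mom →ₗ[ℝ] (Fin k → ℝ) := LinearMap.pi fun i => Module.Dual.eval ℝ Alg (Y i)
  have hφ : Function.Bijective (φ.domRestrict (LinearMap.range f)) := by
    constructor
    · refine (injective_iff_map_eq_zero _).2 ?_
      rintro ⟨_, X, rfl⟩ h
      exact Subtype.ext (h1 X fun i => congrFun h i)
    · intro y
      obtain ⟨X, hX⟩ := h2 y
      exact ⟨⟨f X, X, rfl⟩, funext hX⟩
  rw [(LinearEquiv.ofBijective _ hφ).finrank_eq, Module.finrank_fin_fun]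

namespace Alg

/-- The generators `L(eᵢ)`. -/
def bL (i : Fin 3) : Alg := ⟨Pi.single i 1, 0, 0, 0, 0, 0, 0⟩
/-- The generators `Pᵢ`. -/
def bP (i : Fin 3) : Alg := ⟨0, Pi.single i 1, 0, 0, 0, 0, 0⟩
/-- The generators `Dᵢ`. -/
def bD (i : Fin 3) : Alg := ⟨0, 0, Pi.single i 1, 0, 0, 0, 0⟩
/-- The generator `Z`. -/
def bZ : Alg := ⟨0, 0, 0, 0, 1, 0, 0⟩
/-- The generator `H`. -/
def bH : Alg := ⟨0, 0, 0, 0, 0, 1, 0⟩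

end Alg

section
variable (q qt : ℝ) (d p j : V3) (E c : ℝ)

@[simp] theorem mom_bL (i : Fin 3) : mom q qt d p j E c (Alg.bL i) = j i := by
  simp [mom_apply, Alg.bL]
@[simp] theorem mom_bP (i : Fin 3) : mom q qt d p j E c (Alg.bP i) = p i := by
  simp [mom_apply, Alg.bP]
@[simp] theorem mom_bD (i : Fin 3) : mom q qt d p j E c (Alg.bD i) = -d i := by
  simp [mom_apply, Alg.bD]
@[simp] theorem mom_bZ : mom q qt d p j E c Alg.bZ = qt := by
  simp [mom_apply, Alg.bZ]
@[simp] theorem mom_bH : mom q qt d p j E c Alg.bH = E := by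
  simp [mom_apply, Alg.bH]

end

theorem mom_eq_zero {qt E : ℝ} {d p j : V3} (hqt : qt = 0) (hd : ∀ i, d i = 0) (hp : ∀ i, p i = 0)
    (hj : ∀ i, j i = 0) (hE : E = 0) : mom 0 qt d p j E 0 = 0 := by
  obtain ⟨rfl, rfl, rfl⟩ : d = 0 ∧ p = 0 ∧ j = 0 := ⟨funext hd, funext hp, funext hj⟩
  subst hqt hE
  ext X
  simp [mom_apply]

/-- The tangent vectors at the moment `M(q, qt, (d, 0, 0), (k, p, 0), (h, 0, 0), E, c)`. -/
def tangent (q d k p h c : ℝ) (X : Alg) : Mom :=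
  mom 0 (d * X.P 0 - c * X.H) ![q * X.P 0, d * X.L 2 + q * X.P 1, -(d * X.L 1) + q * X.P 2]
    ![-(p * X.L 2) + q * X.D 0 - X.Z * d, k * X.L 2 + q * X.D 1,
      p * X.L 0 - k * X.L 1 + q * X.D 2]
    ![-(p * X.P 2), h * X.L 2 - d * X.D 2 + k * X.P 2,
      -(h * X.L 1) + d * X.D 1 + p * X.P 0 - k * X.P 1] (c * X.Z) 0

/-- In the standard frame all representatives have this one shape, so the tangent vectors are
computed once. Each row then only needs a choice of coordinates. -/
theorem orbitDim_eq_of_eval {n : ℕ} {α : Mom} (q qt d k p h E c : ℝ) (Y : Fin n → Alg)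
    (hα : α = mom q qt (d • ![1, 0, 0]) (p • ![0, 1, 0] + k • ![1, 0, 0]) (h • ![1, 0, 0]) E c)
    (h1 : ∀ X, (∀ i, tangent q d k p h c X (Y i) = 0) → tangent q d k p h c X = 0)
    (h2 : ∀ y : Fin n → ℝ, ∃ X, ∀ i, tangent q d k p h c X (Y i) = y i) :
    orbitDim α = n := by
  have key : ∀ X, adStar α X = tangent q d k p h c X := fun X => by
    rw [hα, adStar_mom, tangent, mom_inj]
    refine ⟨rfl, ?_, V3.ext ?_ ?_ ?_, V3.ext ?_ ?_ ?_, V3.ext ?_ ?_ ?_, rfl, rfl⟩ <;>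
      simp only [dot_eq, cross_zero, cross_one, cross_two, Pi.add_apply, Pi.sub_apply,
        Pi.smul_apply, smul_eq_mul, Matrix.cons_val] <;> ring
  simp only [← key] at h1 h2
  exact finrank_range_eq_of_eval _ Y h1 h2

-- The generators listed in each row are coordinates of the moment that vary independently along the
-- orbit and determine the other components of a tangent vector. The displayed algebra element
-- attains prescribed values `y`; it is found by solving the triangular system, with the rotation
-- part feeding into the rest.
open Alg in
theorem orbitDim_rep_standard {r : Row} (hr : r.Admissible) :
    orbitDim (r.rep ![1, 0, 0] ![0, 1, 0]) = r.dim := by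
  cases r <;> simp only [Row.rep, Row.Admissible, Row.dim] at hr ⊢
  case orb0 qt₀ E₀ =>
    refine orbitDim_eq_of_eval 0 qt₀ 0 0 0 0 E₀ 0 ![]
      (by simp) (fun X h => ?_) fun y =>
      ⟨0, ?_⟩
    · simp [tangent] at h
      refine mom_eq_zero ?_ ?_ ?_ ?_ ?_ <;> simp [Fin.forall_fin_succ]
    · simp [tangent]
  case orb2 ℓ qt₀ E₀ =>
    refine orbitDim_eq_of_eval 0 qt₀ 0 0 0 ℓ E₀ 0 ![bL 1, bL 2]
      (by simp) (fun X h => ?_) fun y =>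
      ⟨⟨![0, -y 1 / ℓ, y 0 / ℓ], 0, 0, 0, 0, 0, 0⟩, ?_⟩
    · simp [tangent, Fin.forall_fin_succ] at h
      refine mom_eq_zero ?_ ?_ ?_ ?_ ?_ <;> try simp [Fin.forall_fin_succ]
      all_goals grind
    · simp [tangent, Fin.forall_fin_succ]
      field_simp
      simp
  case orb2p c₀ =>
    refine orbitDim_eq_of_eval 0 0 0 0 0 0 0 c₀ ![bZ, bH]
      (by simp) (fun X h => ?_) fun y =>
      ⟨⟨0, 0, 0, 0, y 1 / c₀, -y 0 / c₀, 0⟩, ?_⟩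
    · simp [tangent, Fin.forall_fin_succ] at h
      refine mom_eq_zero ?_ ?_ ?_ ?_ ?_ <;> try simp [Fin.forall_fin_succ]
      all_goals grind
    · simp [tangent, Fin.forall_fin_succ]
      field_simp
      simp
  case orb4 p₀ h₀ qt₀ E₀ =>
    refine orbitDim_eq_of_eval 0 qt₀ 0 p₀ 0 h₀ E₀ 0 ![bP 1, bP 2, bL 1, bL 2]
      (by simp) (fun X h => ?_) fun y =>
      ⟨⟨![0, -y 1 / p₀, y 0 / p₀],
      ![0, (h₀ * y 1 / p₀ - y 3) / p₀, (y 2 - h₀ * y 0 / p₀) / p₀], 0, 0, 0, 0, 0⟩, ?_⟩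
    · simp [tangent, Fin.forall_fin_succ] at h
      refine mom_eq_zero ?_ ?_ ?_ ?_ ?_ <;> try simp [Fin.forall_fin_succ]
      all_goals grind
    · simp [tangent, Fin.forall_fin_succ]
      field_simp
      simp
  case orb4p ℓ c₀ =>
    obtain ⟨hl, hc⟩ := hr
    refine orbitDim_eq_of_eval 0 0 0 0 0 ℓ 0 c₀ ![bZ, bH, bL 1, bL 2]
      (by simp) (fun X h => ?_) fun y =>
      ⟨⟨![0, -y 3 / ℓ, y 2 / ℓ], 0, 0, 0, y 1 / c₀, -y 0 / c₀, 0⟩, ?_⟩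
    · simp [tangent, Fin.forall_fin_succ] at h
      refine mom_eq_zero ?_ ?_ ?_ ?_ ?_ <;> try simp [Fin.forall_fin_succ]
      all_goals grind
    · simp [tangent, Fin.forall_fin_succ]
      field_simp
      simp
  case orb6 q₀ qt₀ E₀ =>
    refine orbitDim_eq_of_eval q₀ qt₀ 0 0 0 0 E₀ 0 ![bD 0, bD 1, bD 2, bP 0, bP 1, bP 2]
      (by simp) (fun X h => ?_) fun y =>
      ⟨⟨0, ![-y 0 / q₀, -y 1 / q₀, -y 2 / q₀], ![y 3 / q₀, y 4 / q₀, y 5 / q₀], 0, 0, 0, 0⟩, ?_⟩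
    · simp [tangent, Fin.forall_fin_succ] at h
      refine mom_eq_zero ?_ ?_ ?_ ?_ ?_ <;> try simp [Fin.forall_fin_succ]
      all_goals grind
    · simp [tangent, Fin.forall_fin_succ]
      field_simp
      simp
  case orb6p d₀ h₀ E₀ =>
    refine orbitDim_eq_of_eval 0 0 d₀ 0 0 h₀ E₀ 0 ![bZ, bD 1, bD 2, bP 0, bL 1, bL 2]
      (by simp) (fun X h => ?_) fun y =>
      ⟨⟨![0, y 2 / d₀, -y 1 / d₀], ![y 0 / d₀, 0, 0],
      ![0, (y 5 + h₀ * y 2 / d₀) / d₀, (-(h₀ * y 1) / d₀ - y 4) / d₀], 0, -y 3 / d₀, 0, 0⟩, ?_⟩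
    · simp [tangent, Fin.forall_fin_succ] at h
      refine mom_eq_zero ?_ ?_ ?_ ?_ ?_ <;> try simp [Fin.forall_fin_succ]
      all_goals grind
    · simp [tangent, Fin.forall_fin_succ]
      field_simp
      simp
  case orb6pp p₀ h₀ c₀ =>
    obtain ⟨hp, hc⟩ := hr
    refine orbitDim_eq_of_eval 0 0 0 p₀ 0 h₀ 0 c₀ ![bZ, bH, bP 1, bP 2, bL 1, bL 2]
      (by simp) (fun X h => ?_) fun y =>
      ⟨⟨![0, -y 3 / p₀, y 2 / p₀],
      ![0, (h₀ * y 3 / p₀ - y 5) / p₀, (y 4 - h₀ * y 2 / p₀) / p₀], 0, 0, y 1 / c₀, -y 0 / c₀, 0⟩,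
        ?_⟩
    · simp [tangent, Fin.forall_fin_succ] at h
      refine mom_eq_zero ?_ ?_ ?_ ?_ ?_ <;> try simp [Fin.forall_fin_succ]
      all_goals grind
    · simp [tangent, Fin.forall_fin_succ]
      field_simp
      simp
  case orb6pppSigned σ E₀ d₀ h₀ c₀ =>
    obtain ⟨-, -, hd, hc⟩ := hr
    -- The value of the component of `p` along `d` does not affect the dimension.
    generalize σ * (E₀ * d₀ / c₀) = κ
    refine orbitDim_eq_of_eval 0 0 d₀ κ 0 h₀ 0 c₀ ![bZ, bH, bD 1, bD 2, bL 1, bL 2]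
      (by simp) (fun X h => ?_) fun y =>
      ⟨⟨![0, y 3 / d₀, -y 2 / d₀], 0,
      ![0, (y 5 + h₀ * y 3 / d₀) / d₀, (-(h₀ * y 2) / d₀ - y 4) / d₀], 0, y 1 / c₀, -y 0 / c₀, 0⟩,
        ?_⟩
    · simp [tangent, Fin.forall_fin_succ] at h
      refine mom_eq_zero ?_ ?_ ?_ ?_ ?_ <;> try simp [Fin.forall_fin_succ]
      all_goals grind
    · simp [tangent, Fin.forall_fin_succ]
      field_simp
      simp
  case orb6pppZero d₀ h₀ c₀ =>
    obtain ⟨hd, hc⟩ := hr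
    refine orbitDim_eq_of_eval 0 0 d₀ 0 0 h₀ 0 c₀ ![bZ, bH, bD 1, bD 2, bL 1, bL 2]
      (by simp) (fun X h => ?_) fun y =>
      ⟨⟨![0, y 3 / d₀, -y 2 / d₀], 0,
      ![0, (y 5 + h₀ * y 3 / d₀) / d₀, (-(h₀ * y 2) / d₀ - y 4) / d₀], 0, y 1 / c₀, -y 0 / c₀, 0⟩,
        ?_⟩
    · simp [tangent, Fin.forall_fin_succ] at h
      refine mom_eq_zero ?_ ?_ ?_ ?_ ?_ <;> try simp [Fin.forall_fin_succ]
      all_goals grind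
    · simp [tangent, Fin.forall_fin_succ]
      field_simp
      simp
  case orb8 ℓ q₀ qt₀ E₀ =>
    obtain ⟨hl, hq⟩ := hr
    refine orbitDim_eq_of_eval q₀ qt₀ 0 0 0 ℓ E₀ 0 ![bD 0, bD 1, bD 2, bP 0, bP 1, bP 2, bL 1, bL 2]
      (by simp) (fun X h => ?_) fun y =>
      ⟨⟨![0, -y 7 / ℓ, y 6 / ℓ], ![-y 0 / q₀, -y 1 / q₀, -y 2 / q₀],
      ![y 3 / q₀, y 4 / q₀, y 5 / q₀], 0, 0, 0, 0⟩, ?_⟩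
    · simp [tangent, Fin.forall_fin_succ] at h
      refine mom_eq_zero ?_ ?_ ?_ ?_ ?_ <;> try simp [Fin.forall_fin_succ]
      all_goals grind
    · simp [tangent, Fin.forall_fin_succ]
      field_simp
      simp
  case orb8p d₀ p₀ E₀ =>
    obtain ⟨hd, hp⟩ := hr
    refine orbitDim_eq_of_eval 0 0 d₀ 0 p₀ 0 E₀ 0 ![bZ, bD 1, bD 2, bP 0, bP 2, bL 0, bL 1, bL 2]
      (by simp) (fun X h => ?_) fun y =>
      ⟨⟨![y 4 / p₀, y 2 / d₀, -y 1 / d₀], ![y 0 / d₀, 0, -y 5 / p₀],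
      ![0, (y 7 - p₀ * y 0 / d₀) / d₀, -y 6 / d₀], 0, (p₀ * y 1 / d₀ - y 3) / d₀, 0, 0⟩, ?_⟩
    · simp [tangent, Fin.forall_fin_succ] at h
      refine mom_eq_zero ?_ ?_ ?_ ?_ ?_ <;> try simp [Fin.forall_fin_succ]
      all_goals grind
    · simp [tangent, Fin.forall_fin_succ]
      field_simp
      simp
  case orb8pp d₀ p₀ ε₀ c₀ =>
    obtain ⟨hd, hp, hc⟩ := hr
    generalize ε₀ * d₀ / c₀ = κ
    refine orbitDim_eq_of_eval 0 0 d₀ κ p₀ 0 0 c₀ ![bZ, bH, bD 1, bD 2, bP 2, bL 0, bL 1, bL 2]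
      (by simp) (fun X h => ?_) fun y =>
      ⟨⟨![(y 4 + κ * y 3 / d₀) / p₀, y 3 / d₀, -y 2 / d₀], ![0, 0, -y 5 / p₀],
      ![0, y 7 / d₀, (-(κ * y 5) / p₀ - y 6) / d₀], 0, y 1 / c₀, -y 0 / c₀, 0⟩, ?_⟩
    · simp [tangent, Fin.forall_fin_succ] at h
      refine mom_eq_zero ?_ ?_ ?_ ?_ ?_ <;> try simp [Fin.forall_fin_succ]
      all_goals grind
    · simp [tangent, Fin.forall_fin_succ]
      field_simp
      simp
  case orb8ppp r c₀ =>
    obtain ⟨hr, hc⟩ := hr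
    have hq : r * c₀ ≠ 0 := mul_ne_zero hr hc
    generalize r * c₀ = q at *
    refine orbitDim_eq_of_eval q 0 0 0 0 0 0 c₀ ![bZ, bH, bD 0, bD 1, bD 2, bP 0, bP 1, bP 2]
      (by simp) (fun X h => ?_) fun y =>
      ⟨⟨0, ![-y 2 / q, -y 3 / q, -y 4 / q], ![y 5 / q, y 6 / q, y 7 / q],
      0, y 1 / c₀, -y 0 / c₀, 0⟩, ?_⟩
    · simp [tangent, Fin.forall_fin_succ] at h
      refine mom_eq_zero ?_ ?_ ?_ ?_ ?_ <;> try simp [Fin.forall_fin_succ]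
      all_goals grind
    · simp [tangent, Fin.forall_fin_succ]
      field_simp
      simp
  case orb10 ℓ r c₀ =>
    obtain ⟨hl, hr, hc⟩ := hr
    have hq : r * c₀ ≠ 0 := mul_ne_zero hr hc
    generalize r * c₀ = q at *
    refine orbitDim_eq_of_eval q 0 0 0 0 ℓ 0 c₀ ![bZ, bH, bD 0, bD 1, bD 2, bP 0, bP 1, bP 2, bL 1, bL 2]
      (by simp) (fun X h => ?_) fun y =>
      ⟨⟨![0, -y 9 / ℓ, y 8 / ℓ], ![-y 2 / q, -y 3 / q, -y 4 / q],
      ![y 5 / q, y 6 / q, y 7 / q], 0, y 1 / c₀, -y 0 / c₀, 0⟩, ?_⟩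
    · simp [tangent, Fin.forall_fin_succ] at h
      refine mom_eq_zero ?_ ?_ ?_ ?_ ?_ <;> try simp [Fin.forall_fin_succ]
      all_goals grind
    · simp [tangent, Fin.forall_fin_succ]
      field_simp
      simp

/-- The locus does not mention the frame, so the representative may be taken in the standard one. -/
theorem orbitDim_of_mem_locus {r : Row} (hr : r.Admissible) {α : Mom} (hα : α ∈ r.locus) :
    orbitDim α = r.dim := by
  rw [← orbit_rep (u := ![1, 0, 0]) (v := ![0, 1, 0]) (by simp) (by simp) (by simp) hr] at hα
  obtain ⟨g, rfl⟩ := hα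
  exact (orbitDim_smul g _).trans (orbitDim_rep_standard hr)

/-! ### Completeness of the list -/

namespace Row

open Classical in
/-- The row of the list to which a moment belongs. -/
def classify (q qt : ℝ) (d p j : V3) (E c : ℝ) : Row :=
  if c = 0 then
    if q = 0 then
      if d = 0 then
        if p = 0 then
          if j = 0 then orb0 qt E else orb2 (len j) qt E
        else orb4 (len p) (j ⬝ᵥ p / len p) qt E
      else if d ⨯₃ p = 0 then orb6p (len d) (j ⬝ᵥ d / len d) E
      else orb8p (len d) (len (d ⨯₃ p) / len d) E
    else if q • j = d ⨯₃ p then orb6 q (qt - len d ^ 2 / (2 * q)) E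
    else orb8 (len (j - (1 / q) • (d ⨯₃ p))) q (qt - len d ^ 2 / (2 * q)) E
  else if q = 0 then
    if d = 0 then
      if p = 0 then
        if j = 0 then orb2p c else orb4p (len j) c
      else orb6pp (len p) (j ⬝ᵥ p / len p) c
    else if p ⨯₃ d = 0 then
      if E + c * (p ⬝ᵥ d) / len d ^ 2 = 0 then orb6pppZero (len d) (j ⬝ᵥ d / len d) c
      -- For `p` parallel to `d`, this number is the factor by which `E d + c p` is a multiple of
      -- `d`. It is nonzero in this branch, so its sign selects the family and its absolute value is
      -- `E₀`.
      else orb6pppSigned (if 0 < E + c * (p ⬝ᵥ d) / len d ^ 2 then 1 else -1)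
        |E + c * (p ⬝ᵥ d) / len d ^ 2| (len d) (j ⬝ᵥ d / len d) c
    else orb8pp (len d) (len (p ⨯₃ d) / len d) (E + c * (p ⬝ᵥ d) / len d ^ 2) c
  else if q • j = d ⨯₃ p then orb8ppp (q / c) c
  else orb10 (len (j - (1 / q) • (d ⨯₃ p))) (q / c) c

/-- This is the vanishing of the intrinsic spin, which separates `6` from `8` and `8'''` from `10`.
-/
theorem smul_eq_iff_sub_eq_zero {q : ℝ} (hq : q ≠ 0) {j x : V3} :
    q • j = x ↔ j - (1 / q) • x = 0 := by
  rw [one_div, sub_eq_zero, eq_inv_smul_iff₀ hq]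

theorem smul_add_smul_eq_iff {d p : V3} (hd : d ≠ 0) (hpd : p ⨯₃ d = 0) {E c e : ℝ} :
    E • d + c • p = e • d ↔ e = E + c * (p ⬝ᵥ d) / len d ^ 2 := by
  have hdp : d ⨯₃ p = 0 := by rw [← cross_anticomm, hpd, neg_zero]
  have hp := eq_smul_of_cross_eq_zero hd hdp
  have h : E • d + c • p = (E + c * (p ⬝ᵥ d) / len d ^ 2) • d := by
    conv_lhs => rw [hp]
    rw [len_sq, smul_smul, ← add_smul, mul_div_assoc]
  rw [h, smul_left_inj hd, eq_comm]

theorem eq_neg_smul_iff {d p : V3} (hd : d ≠ 0) (hpd : p ⨯₃ d = 0) {E c : ℝ}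
    (hc : c ≠ 0) :
    p = -(E / c) • d ↔ E + c * (p ⬝ᵥ d) / len d ^ 2 = 0 := by
  rw [eq_comm (b := (0 : ℝ)), ← smul_add_smul_eq_iff hd hpd, zero_smul]
  constructor
  · intro h
    rw [h, smul_smul, ← add_smul]
    field_simp
    simp
  · intro h
    rw [← smul_right_inj hc, smul_smul, eq_neg_of_add_eq_zero_right h, ← neg_smul]
    congr 1
    field_simp

variable {q qt E c : ℝ} {d p j : V3}

theorem classify_spec (q qt : ℝ) (d p j : V3) (E c : ℝ) :
    (classify q qt d p j E c).Admissible ∧ (classify q qt d p j E c).Eqns q qt d p j E c := by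
  have hlen : ∀ {x : V3}, x ≠ 0 → len x ≠ 0 := fun h => (len_pos.2 h).ne'
  unfold classify
  split_ifs with hc hq hd hp hj hdp hj hq hd hp hj hpd he he' hj <;>
    simp only [Admissible, Eqns, len_pos, true_and, and_true, ne_eq, not_false_eq_true, *]
  · rw [div_mul_cancel₀ _ (hlen hp)]
  · rw [div_mul_cancel₀ _ (hlen hd)]
  · exact ⟨div_pos (len_pos.2 hdp) (len_pos.2 hd), (mul_div_cancel₀ _ (hlen hd)).symm⟩
  · rwa [← smul_eq_iff_sub_eq_zero hq]
  · rw [div_mul_cancel₀ _ (hlen hp)]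
  · exact ⟨(eq_neg_smul_iff hd hpd hc).2 he, (div_mul_cancel₀ _ (hlen hd)).symm⟩
  · refine ⟨⟨Or.inl trivial, abs_pos.2 he⟩, (div_mul_cancel₀ _ (hlen hd)).symm, ?_⟩
    rw [smul_add_smul_eq_iff hd hpd, abs_of_pos he', one_mul]
  · refine ⟨⟨Or.inr trivial, abs_pos.2 he⟩, (div_mul_cancel₀ _ (hlen hd)).symm, ?_⟩
    rw [smul_add_smul_eq_iff hd hpd, abs_of_nonpos (not_lt.1 he'), neg_one_mul, neg_neg]
  · refine ⟨div_pos (len_pos.2 hpd) (len_pos.2 hd), (div_mul_cancel₀ _ (hlen hd)).symm, ?_⟩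
    have := hlen hd
    field_simp
    ring
  · exact ⟨div_ne_zero hq hc, (div_mul_cancel₀ _ hc).symm⟩
  · rw [← smul_eq_iff_sub_eq_zero hq]
    exact ⟨⟨hj, div_ne_zero hq hc⟩, (div_mul_cancel₀ _ hc).symm⟩

/-- The equations recover the parameters and decide every branch of `classify`, so uniqueness needs
no pairwise comparison of rows. -/
theorem eq_classify {r : Row} (hr : r.Admissible) (h : r.Eqns q qt d p j E c) :
    r = classify q qt d p j E c := by
  cases r <;> simp only [Admissible, Eqns] at hr h
  case orb0 =>
    obtain ⟨rfl, rfl, rfl, rfl, rfl, rfl, rfl⟩ := h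
    simp [classify]
  case orb2 =>
    obtain ⟨rfl, rfl, rfl, rfl, rfl, rfl, rfl⟩ := h
    simp [classify, len_pos.1 hr]
  case orb2p =>
    obtain ⟨rfl, rfl, rfl, rfl, rfl⟩ := h
    simp [classify, hr]
  case orb4 =>
    obtain ⟨rfl, rfl, rfl, rfl, rfl, rfl, hj⟩ := h
    simp [classify, len_pos.1 hr, hj, hr.ne']
  case orb4p =>
    obtain ⟨rfl, rfl, rfl, rfl, rfl⟩ := h
    simp [classify, len_pos.1 hr.1, hr.2]
  case orb6 =>
    obtain ⟨rfl, rfl, rfl, rfl, hj⟩ := h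
    simp [classify, hr, hj]
  case orb6p =>
    obtain ⟨rfl, rfl, rfl, rfl, hp, hj⟩ := h
    simp [classify, len_pos.1 hr, hp, hj, hr.ne']
  case orb6pp =>
    obtain ⟨rfl, rfl, rfl, rfl, hj⟩ := h
    simp [classify, len_pos.1 hr.1, hr.2, hj, hr.1.ne']
  case orb6pppSigned σ E₀ d₀ h₀ c₀ =>
    obtain ⟨rfl, rfl, hp, rfl, hj, he⟩ := h
    obtain ⟨hσ, hE, hd, hc⟩ := hr
    rw [smul_add_smul_eq_iff (len_pos.1 hd) hp] at he
    have hj' : h₀ = j ⬝ᵥ d / len d := by rw [hj, mul_div_cancel_right₀ _ hd.ne']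
    simp only [classify, hc, len_pos.1 hd, hp, if_true, if_false, ← he, ← hj']
    rcases hσ with rfl | rfl
    · simp [hE, hE.ne', abs_of_pos]
    · simp [hE.ne', hE.le, abs_of_pos hE]
  case orb6pppZero d₀ h₀ c₀ =>
    obtain ⟨rfl, rfl, hp, rfl, hj⟩ := h
    obtain ⟨hd, hc⟩ := hr
    have hpd : p ⨯₃ d = 0 := by rw [hp, smul_cross, cross_self, smul_zero]
    have hj' : h₀ = j ⬝ᵥ d / len d := by rw [hj, mul_div_cancel_right₀ _ hd.ne']
    rw [eq_neg_smul_iff (len_pos.1 hd) hpd hc] at hp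
    simp only [classify, hc, len_pos.1 hd, hpd, if_true, if_false, ← hj', hp]
  case orb8 =>
    obtain ⟨rfl, rfl, rfl, rfl, rfl⟩ := h
    simp only [classify, hr.2, smul_eq_iff_sub_eq_zero hr.2, len_pos.1 hr.1, if_true, if_false]
  case orb8p d₀ p₀ E₀ =>
    obtain ⟨rfl, rfl, rfl, rfl, hp⟩ := h
    have hdp : d ⨯₃ p ≠ 0 := len_pos.1 (hp ▸ mul_pos hr.1 hr.2)
    have hp' : p₀ = len (d ⨯₃ p) / len d := by rw [hp, mul_div_cancel_left₀ _ hr.1.ne']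
    simp only [classify, len_pos.1 hr.1, hdp, if_true, if_false, ← hp']
  case orb8pp d₀ p₀ ε₀ c₀ =>
    obtain ⟨rfl, rfl, rfl, hp, he⟩ := h
    obtain ⟨hd, hp0, hc⟩ := hr
    have hdp : p ⨯₃ d ≠ 0 := len_pos.1 (hp ▸ mul_pos hp0 hd)
    have hp' : p₀ = len (p ⨯₃ d) / len d := by rw [hp, mul_div_cancel_right₀ _ hd.ne']
    have he' : ε₀ = E + c * (p ⬝ᵥ d) / len d ^ 2 := by
      field_simp
      linarith
    simp only [classify, hc, len_pos.1 hd, hdp, if_true, if_false, ← hp', ← he']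
  case orb8ppp r c₀ =>
    obtain ⟨rfl, hq, hj⟩ := h
    have hq0 : q ≠ 0 := hq ▸ mul_ne_zero hr.1 hr.2
    have hr' : r = q / c := by rw [hq, mul_div_cancel_right₀ _ hr.2]
    simp only [classify, hr.2, hq0, hj, if_true, if_false, ← hr']
  case orb10 ℓ r c₀ =>
    obtain ⟨rfl, hq, rfl⟩ := h
    have hq0 : q ≠ 0 := hq ▸ mul_ne_zero hr.2.1 hr.2.2
    have hr' : r = q / c := by rw [hq, mul_div_cancel_right₀ _ hr.2.2]
    simp only [classify, hr.2.2, hq0, smul_eq_iff_sub_eq_zero hq0, len_pos.1 hr.1, if_false, ← hr']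

end Row

theorem existsUnique_row (α : Mom) : ∃! r : Row, r.Admissible ∧ α ∈ r.locus := by
  obtain ⟨q, qt, d, p, j, E, c, rfl⟩ := exists_mom α
  simp only [Row.mom_mem_locus]
  exact ⟨_, Row.classify_spec q qt d p j E c, fun r h => Row.eq_classify h.1 h.2⟩

/-! ### The Bargmann group inside the planon group -/

/-- The Bargmann part of a group element. -/
def bargmannPart (g : Grp) : bargmannGroup := ⟨⟨g.φ, g.φt, g.β, g.a, g.R, 0, 0⟩, rfl, rfl⟩

theorem bargmannPart_coe (b : bargmannGroup) : bargmannPart b = b :=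
  Subtype.ext (Grp.ext rfl rfl rfl rfl rfl b.2.1.symm b.2.2.symm)

theorem abelianGroup_normal : abelianGroup.Normal := by
  refine ⟨fun x ⟨h1, h2, h3, h4, h5⟩ g => ?_⟩
  refine ⟨?_, ?_, ?_, ?_, ?_⟩
  · simp [h1, h2, h3, h4, h5]
    ring
  · simp [h2]
  · simp [h2, h3, h4, h5]
  · simp [h4, h5]
  · simp [h5]

theorem abelianGroup_comm {x y : Grp} (hx : x ∈ abelianGroup) (hy : y ∈ abelianGroup) :
    x * y = y * x := by
  obtain ⟨h1, h2, h3, h4, h5⟩ := hx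
  obtain ⟨k1, k2, k3, k4, k5⟩ := hy
  ext1 <;> simp [h1, h2, h3, h4, h5, k1, k2, k3, k4, k5, add_comm]

theorem isComplement'_bargmannGroup_abelianGroup :
    Subgroup.IsComplement' bargmannGroup abelianGroup := by
  constructor
  · rintro ⟨⟨b, hb1, hb2⟩, x, h1, h2, h3, h4, h5⟩ ⟨⟨b', hb1', hb2'⟩, x', h1', h2', h3', h4', h5'⟩ h
    have h' : b * x = b' * x' := h
    have e1 := congrArg Grp.φ h'
    have e2 := congrArg Grp.φt h'
    have e3 := congrArg Grp.β h'
    have e4 := congrArg Grp.a h'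
    have e5 := congrArg Grp.R h'
    have e6 := congrArg Grp.s h'
    have e7 := congrArg Grp.w h'
    simp [h1, h2, h3, h4, h5, h1', h2', h3', h4', h5', hb1, hb2, hb1', hb2'] at e1 e2 e3 e4 e5 e6 e7
    obtain rfl : b = b' := Grp.ext e1 e2 e3 e4 e5 (hb1.trans hb1'.symm) (hb2.trans hb2'.symm)
    obtain rfl : x = x' := Grp.ext (h1.trans h1'.symm) (h2.trans h2'.symm) (h3.trans h3'.symm)
      (h4.trans h4'.symm) (h5.trans h5'.symm) e6 e7
    rfl
  · intro g
    refine ⟨⟨bargmannPart g, ⟨0, 0, 0, 0, 1, g.s, g.w⟩, rfl, rfl, rfl, rfl, rfl⟩, ?_⟩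
    change (bargmannPart g : Grp) * _ = g
    ext1 <;> simp [bargmannPart]

theorem atEnergy_apply (E : ℝ) (β : Module.Dual ℝ bargmannAlg) (X : Alg) :
    atEnergy E β X = β (bargmannProj X) + E * X.H := by
  simp [atEnergy, mom_apply]

theorem bargmannProj_coe (X : bargmannAlg) : bargmannProj X = X :=
  Subtype.ext (Alg.ext rfl rfl rfl rfl rfl X.2.1.symm X.2.2.symm)

theorem atEnergy_injective (E : ℝ) : Function.Injective (atEnergy E) := fun β γ h => by
  ext X
  have h' := LinearMap.congr_fun h X
  rwa [atEnergy_apply, atEnergy_apply, bargmannProj_coe, add_left_inj] at h'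

/-- On moments with `c = 0`, the terms by which `s` shifts `qt` and `φt` shifts `E` carry the factor
`c` and vanish. Thus only the Bargmann part of `g` acts and the energy is constant. -/
theorem smul_atEnergy (E : ℝ) (β : Module.Dual ℝ bargmannAlg) (g : Grp) :
    g • atEnergy E β = atEnergy E (bargmannPart g • β) := by
  ext X
  rw [coadj_apply, atEnergy_apply, atEnergy_apply]
  change _ = β (bargmannAd (bargmannPart g)⁻¹ (bargmannProj X)) + _
  congr 2
  · apply Subtype.ext
    change _ = adj (bargmannPart g : Grp)⁻¹ (bargmannProj X : Alg)
    simp only [adj_eq]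
    ext1 <;> simp [bargmannProj, bargmannPart]
  · simp [adj_eq]

/-- Both inclusions rest on `smul_atEnergy`: each `g` acts as its Bargmann part, and an element of
the Bargmann group is its own Bargmann part. -/
theorem image_atEnergy_orbit (E : ℝ) (β : Module.Dual ℝ bargmannAlg) :
    atEnergy E '' MulAction.orbit bargmannGroup β = MulAction.orbit Grp (atEnergy E β) := by
  ext α
  constructor
  · rintro ⟨_, ⟨b, rfl⟩, rfl⟩
    refine ⟨b, ?_⟩
    change (b : Grp) • atEnergy E β = _
    rw [smul_atEnergy, bargmannPart_coe]
  · rintro ⟨g, rfl⟩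
    exact ⟨_, ⟨bargmannPart g, rfl⟩, (smul_atEnergy E β g).symm⟩

theorem exists_atEnergy_eq_mom (E : ℝ) (β : Module.Dual ℝ bargmannAlg) :
    ∃ q qt d p j, atEnergy E β = mom q qt d p j E 0 := by
  obtain ⟨q, qt, d, p, j, E', c, h⟩ := exists_mom (atEnergy E β)
  have hz : ∀ s w : ℝ, bargmannProj ⟨0, 0, 0, 0, 0, s, w⟩ = 0 := fun s w => rfl
  have hE := LinearMap.congr_fun h ⟨0, 0, 0, 0, 0, 1, 0⟩
  have hc := LinearMap.congr_fun h ⟨0, 0, 0, 0, 0, 0, 1⟩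
  rw [atEnergy_apply, mom_apply, hz] at hE hc
  simp at hE hc
  exact ⟨q, qt, d, p, j, by rw [h, hE, hc]⟩

theorem exists_mom_eq_atEnergy (q qt : ℝ) (d p j : V3) (E : ℝ) :
    ∃ β, mom q qt d p j E 0 = atEnergy E β := by
  refine ⟨mom q qt d p j E 0 ∘ₗ bargmannAlg.toSubmodule.subtype, ?_⟩
  ext X
  rw [atEnergy_apply]
  change _ = mom q qt d p j E 0 ⟨X.L, X.P, X.D, X.Q, X.Z, 0, 0⟩ + E * X.H
  simp [mom_apply]

theorem bijOn_image_atEnergy (E : ℝ) : Set.BijOn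
    (fun O : Set (Module.Dual ℝ bargmannAlg) => atEnergy E '' O)
    {O | ∃ β : Module.Dual ℝ bargmannAlg, O = MulAction.orbit bargmannGroup β}
    {O | ∃ (q qt : ℝ) (d p j : V3), O = MulAction.orbit Grp (mom q qt d p j E 0)} := by
  refine ⟨?_, (atEnergy_injective E).image_injective.injOn, ?_⟩
  · rintro _ ⟨β, rfl⟩
    obtain ⟨q, qt, d, p, j, h⟩ := exists_atEnergy_eq_mom E β
    exact ⟨q, qt, d, p, j, by rw [← h]; exact image_atEnergy_orbit E β⟩
  · rintro _ ⟨q, qt, d, p, j, rfl⟩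
    obtain ⟨β, h⟩ := exists_mom_eq_atEnergy q qt d p j E
    exact ⟨_, ⟨β, rfl⟩, by rw [h]; exact image_atEnergy_orbit E β⟩

end Planon

end

theorem mainTheorem1 :
    -- the extended planon group is the semidirect product of the Bargmann group and `A`
    (Planon.abelianGroup.Normal ∧
      (∀ x ∈ Planon.abelianGroup, ∀ y ∈ Planon.abelianGroup, x * y = y * x) ∧
      Subgroup.IsComplement' Planon.bargmannGroup Planon.abelianGroup) ∧
    -- equations, stabiliser and dimension of each listed orbit
    (∀ u v : Planon.V3, u ⬝ᵥ u = 1 → v ⬝ᵥ v = 1 → u ⬝ᵥ v = 0 →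
      ∀ r : Planon.Row, r.Admissible →
        MulAction.orbit Planon.Grp (r.rep u v) = r.locus ∧
        (MulAction.stabilizer Planon.Grp (r.rep u v) : Set Planon.Grp) = r.stab u v ∧
        ∀ α ∈ r.locus, Planon.orbitDim α = r.dim) ∧
    -- the list is complete and without repetitions
    (∀ α : Planon.Mom, ∃! r : Planon.Row, r.Admissible ∧ α ∈ r.locus) ∧
    -- the orbits with `c = 0` and energy `E` are the Bargmann orbits placed at energy `E`
    (∀ E : ℝ, Set.BijOn
      (fun O : Set (Module.Dual ℝ Planon.bargmannAlg) => Planon.atEnergy E '' O)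
      {O | ∃ β : Module.Dual ℝ Planon.bargmannAlg,
        O = MulAction.orbit Planon.bargmannGroup β}
      {O | ∃ (q qt : ℝ) (d p j : Planon.V3),
        O = MulAction.orbit Planon.Grp (Planon.mom q qt d p j E 0)}) := by
  refine ⟨⟨Planon.abelianGroup_normal, fun _ hx _ hy => Planon.abelianGroup_comm hx hy,
    Planon.isComplement'_bargmannGroup_abelianGroup⟩, ?_, Planon.existsUnique_row,
    Planon.bijOn_image_atEnergy⟩
  intro u v hu hv huv r hr
  exact ⟨Planon.orbit_rep hu hv huv hr, Planon.stabilizer_rep hu hv huv hr,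
    fun _ hα => Planon.orbitDim_of_mem_locus hr hα⟩
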